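/- Let $\ell\ge 2$, $\lambda_\ell=\ell(\ell+1)$, and let $f_\ell=\sqrt{\tfrac{4\pi}{2\ell+1}}\sum_{m=-\ell}^{\ell}a_{\ell m}Y_{\ell m}$ be the random spherical eigenfunction on the unit sphere $\mathbb S^2$, where $Y_{\ell m}(\theta,\varphi)$ are the standard complex spherical harmonics in spherical coordinates and $a_{\ell m}$ are random coefficients on a probability space such that: for $m\neq0$, $\mathrm{Re}(a_{\ell m})$ and $\mathrm{Im}(a_{\ell m})$ are independent $N(0,\tfrac12)$ variables; $a_{\ell 0}$ is a real $N(0,1)$ variable; $a_{\ell m}$ and $a_{\ell m'}$ are independent whenever $m'\neq\pm m$; and $(-1)^m a_{\ell,-m}=\overline{a_{\ell m}}$ almost surely. Let $e_1=\partial_\theta$, $e_2=\frac1{\sin\theta}\partial_\varphi$ be the coordinate orthonormal frame (away from the poles), and let $e_1e_1f=\partial_\theta^2f$, $e_1e_2f=\frac1{\sin\theta}\big(\partial_\theta\partial_\varphi f-\frac{\cos\theta}{\sin\theta}\partial_\varphi f\big)$, $e_2e_2f=\frac1{\sin^2\theta}\big(\partial_\varphi^2f+\sin\theta\cos\theta\,\partial_\theta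 f\big)$ be the components of the covariant Hessian. Define $Y(x)=(Y_1(x),\dots,Y_5(x))$ by $$(e_1f_\ell,e_2f_\ell,e_1e_1f_\ell,e_1e_2f_\ell,e_2e_2f_\ell)(x)=(\lambda_1Y_1,\lambda_1Y_2,\lambda_3Y_3,\lambda_4Y_4,\lambda_5Y_5+\lambda_2Y_3)(x),$$ $$\lambda_1=\sqrt{\tfrac{\lambda_\ell}{2}},\quad \lambda_2=\frac{\sqrt{\lambda_\ell}(\lambda_\ell+2)}{2\sqrt2\sqrt{3\lambda_\ell-2}},\quad \lambda_3=\frac{\sqrt{\lambda_\ell}\sqrt{3\lambda_\ell-2}}{2\sqrt2},\quad \lambda_4=\frac{\sqrt{\lambda_\ell}\sqrt{\lambda_\ell-2}}{2\sqrt2},\quad \lambda_5=\frac{\lambda_\ell\sqrt{\lambda_\ell-2}}{\sqrt{3\lambda_\ell-2}}.$$ Put $A_{35}(\ell)=\int_{\mathbb S^2}Y_3(x)Y_5(x)\,dx$ and $B_i(\ell)=\int_{\mathbb S^2}H_2(Y_i(x))\,dx$, $i=1,\dots,5$, where $H_2(t)=t^2-1$ and $dx=\sin\theta\,d\theta\,d\varphi$.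 Then these integrals converge and, almost surely, $$A_{35}(\ell)=4\pi\frac{\sqrt2}{3}\sum_{m=-\ell}^{\ell}\{|a_{\ell m}|^2-1\}\Big[-\frac1\ell+\frac{3|m|}{\ell^2}-\frac{2|m|^3}{\ell^4}\Big]+r_0(\ell),$$ $$B_1(\ell)=4\pi\sum_{m=-\ell}^{\ell}\{|a_{\ell m}|^2-1\}\Big[\frac1\ell-\frac{|m|}{\ell^2}\Big]+r_1(\ell),$$ $$B_2(\ell)=4\pi\sum_{m=-\ell}^{\ell}\{|a_{\ell m}|^2-1\}\frac{|m|}{\ell^2}+r_2(\ell),$$ $$B_3(\ell)=4\pi\sum_{m=-\ell}^{\ell}\{|a_{\ell m}|^2-1\}\Big[\frac4{3\ell}-\frac{2|m|}{\ell^2}+\frac{2|m|^3}{3\ell^4}\Big]+r_3(\ell),$$ $$B_4(\ell)=4\pi\cdot2\sum_{m=-\ell}^{\ell}\{|a_{\ell m}|^2-1\}\Big[\frac{|m|}{\ell^2}-\frac{|m|^3}{\ell^4}\Big]+r_4(\ell),$$ $$B_5(\ell)=4\pi\cdot\frac16\sum_{m=-\ell}^{\ell}\{|a_{\ell m}|^2-1\}\Big[\frac1\ell+\frac{8|m|^3}{\ell^4}\Big]+r_5(\ell),$$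 where the remainders are square integrable and, for an absolute constant $C$, $\sqrt{\mathbb E[r_i(\ell)^2]}\le C/\ell$ for all $\ell\ge2$ and $i=0,\dots,5$. -/

import Mathlib

open MeasureTheory ProbabilityTheory

noncomputable section

/-! ### Spherical harmonics

Points of the unit sphere (away from the poles) are given by the spherical coordinates
`(θ, φ)`, `θ` the colatitude in `(0, π)` and `φ` the longitude in `(0, 2π)`; a function on the
sphere is written as a function of `(θ, φ)`. -/

/-- The Legendre polynomial `P_ℓ` (Rodrigues' formula). -/
def legendrePoly (l : ℕ) : Polynomial ℝ :=
  Polynomial.C (1 / (2 ^ l * (l.factorial : ℝ))) *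
    (Polynomial.derivative^[l]) ((Polynomial.X ^ 2 - 1) ^ l)

/-- The associated Legendre function
`P_ℓ^k(x) = (-1)^k (1 - x²)^{k/2} (d/dx)^k P_ℓ(x)`, for `k ≥ 0` and `-1 ≤ x ≤ 1`. -/
def assocLegendre (l k : ℕ) (x : ℝ) : ℝ :=
  (-1) ^ k * Real.sqrt (1 - x ^ 2) ^ k *
    ((Polynomial.derivative^[k]) (legendrePoly l)).eval x

/-- The standard complex spherical harmonic `Y_{ℓ m}`, `-ℓ ≤ m ≤ ℓ`: with `k = |m|`,
`Y_{ℓ m} = e^{imφ} √((2ℓ+1)/(4π) · (ℓ-k)!/(ℓ+k)!) P_ℓ^k(cos θ)`,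
multiplied by `(-1)^k` if `m < 0`. -/
def sphHarm (l : ℕ) (m : ℤ) (θ φ : ℝ) : ℂ :=
  (if 0 ≤ m then 1 else (-1) ^ m.natAbs) * Complex.exp (Complex.I * m * φ) *
    ((Real.sqrt ((2 * l + 1) / (4 * Real.pi) *
        ((l - m.natAbs).factorial / (l + m.natAbs).factorial)) *
      assocLegendre l m.natAbs (Real.cos θ) : ℝ) : ℂ)

/-- The spherical eigenfunction `f_ℓ = √(4π/(2ℓ+1)) ∑_{m=-ℓ}^{ℓ} c_m Y_{ℓ m}`.  When
`(-1)^m c_{-m}` is the conjugate of `c_m`, the sum is real and `re` is only a cast. -/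
def sphField (l : ℕ) (c : ℤ → ℂ) (θ φ : ℝ) : ℝ :=
  ((Real.sqrt (4 * Real.pi / (2 * l + 1)) : ℂ) *
    ∑ m ∈ Finset.Icc (-(l : ℤ)) (l : ℤ), c m * sphHarm l m θ φ).re

/-- The random coefficients `a_{ℓ m}`, `-ℓ ≤ m ≤ ℓ`, of the Gaussian spherical harmonic of
degree `ℓ`. -/
structure IsGaussianHarmonicCoeff {Ω : Type*} [MeasurableSpace Ω] (P : Measure Ω)
    (l : ℕ) (a : ℤ → Ω → ℂ) : Prop where
  /-- for `m ≠ 0` the real part is centred Gaussian with variance `1/2` -/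
  re_law : ∀ m : ℤ, |m| ≤ (l : ℤ) → m ≠ 0 →
    HasLaw (fun ω => (a m ω).re) (gaussianReal 0 (1 / 2)) P
  /-- for `m ≠ 0` the imaginary part is centred Gaussian with variance `1/2` -/
  im_law : ∀ m : ℤ, |m| ≤ (l : ℤ) → m ≠ 0 →
    HasLaw (fun ω => (a m ω).im) (gaussianReal 0 (1 / 2)) P
  /-- for `m ≠ 0` the real and imaginary parts are independent -/
  re_im_indep : ∀ m : ℤ, |m| ≤ (l : ℤ) → m ≠ 0 →
    IndepFun (fun ω => (a m ω).re) (fun ω => (a m ω).im) P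
  /-- `a_{ℓ 0}`, which is real by `conj_symm`, is standard Gaussian -/
  zero_law : HasLaw (fun ω => (a 0 ω).re) (gaussianReal 0 1) P
  /-- `a_{ℓ m}` and `a_{ℓ m'}` are independent whenever `m' ≠ ±m` -/
  indep : ∀ m m' : ℤ, |m| ≤ (l : ℤ) → |m'| ≤ (l : ℤ) → m' ≠ m → m' ≠ -m →
    IndepFun (a m) (a m') P
  /-- `(-1)^m a_{ℓ,-m}` is the complex conjugate of `a_{ℓ m}`, almost surely -/
  conj_symm : ∀ m : ℤ, |m| ≤ (l : ℤ) →
    ∀ᵐ ω ∂P, (-1 : ℂ) ^ m * a (-m) ω = (starRingEnd ℂ) (a m ω)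

/-! ### Gradient, Hessian and integration on the sphere -/

/-- `e₁ f = ∂f/∂θ`. -/
def gradOne (f : ℝ → ℝ → ℝ) (θ φ : ℝ) : ℝ :=
  deriv (fun t => f t φ) θ

/-- `e₂ f = (1 / sin θ) ∂f/∂φ`. -/
def gradTwo (f : ℝ → ℝ → ℝ) (θ φ : ℝ) : ℝ :=
  1 / Real.sin θ * deriv (fun s => f θ s) φ

/-- The component `∇²f(e₁, e₁) = ∂²f/∂θ²` of the covariant Hessian. -/
def hessOneOne (f : ℝ → ℝ → ℝ) (θ φ : ℝ) : ℝ :=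
  deriv (fun t => deriv (fun t' => f t' φ) t) θ

/-- The component `∇²f(e₁, e₂) = (1 / sin θ) (∂²f/∂θ∂φ - (cos θ / sin θ) ∂f/∂φ)` of the
covariant Hessian. -/
def hessOneTwo (f : ℝ → ℝ → ℝ) (θ φ : ℝ) : ℝ :=
  1 / Real.sin θ *
    (deriv (fun t => deriv (fun s => f t s) φ) θ -
      Real.cos θ / Real.sin θ * deriv (fun s => f θ s) φ)

/-- The component `∇²f(e₂, e₂) = (1 / sin² θ) (∂²f/∂φ² + sin θ cos θ ∂f/∂θ)` of the covariant
Hessian. -/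
def hessTwoTwo (f : ℝ → ℝ → ℝ) (θ φ : ℝ) : ℝ :=
  1 / Real.sin θ ^ 2 *
    (deriv (fun s => deriv (fun s' => f θ s') s) φ +
      Real.sin θ * Real.cos θ * deriv (fun t => f t φ) θ)

/-- The coordinate domain; its image is the sphere without a half great circle, a null set. -/
def sphChart : Set (ℝ × ℝ) :=
  Set.Ioo 0 Real.pi ×ˢ Set.Ioo 0 (2 * Real.pi)

/-- Integrability with respect to the area measure `sin θ dθ dφ` of the unit sphere. -/
def SphIntegrable (F : ℝ → ℝ → ℝ) : Prop :=
  IntegrableOn (fun p : ℝ × ℝ => F p.1 p.2 * Real.sin p.1) sphChart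

/-- The integral `∫_{S²} F(x) dx` with respect to the area measure `sin θ dθ dφ` of the unit
sphere, whose metric is `dθ² + sin² θ dφ²`. -/
def sphIntegral (F : ℝ → ℝ → ℝ) : ℝ :=
  ∫ p in sphChart, F p.1 p.2 * Real.sin p.1

/-! ### The normalized vector `Y` and the integrals `A_{ij}`, `B_i` -/

/-- `λ_ℓ = ℓ (ℓ + 1)`. -/
def sphEigenvalue (l : ℕ) : ℝ := (l : ℝ) * (l + 1)

/-- The Cholesky factor `Λ_ℓ` of the covariance matrix of
`(e₁f, e₂f, e₁e₁f, e₁e₂f, e₂e₂f)` at a point of the sphere; it is invertible for `ℓ ≥ 2`. -/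
def cholFactor (l : ℕ) : Matrix (Fin 5) (Fin 5) ℝ :=
  let L := sphEigenvalue l
  !![√L / √2, 0, 0, 0, 0;
     0, √L / √2, 0, 0, 0;
     0, 0, √L * √(3 * L - 2) / (2 * √2), 0, 0;
     0, 0, 0, √L * √(L - 2) / (2 * √2), 0;
     0, 0, √L * (L + 2) / (2 * √2 * √(3 * L - 2)), 0, L * √(L - 2) / √(3 * L - 2)]

/-- The vector `(e₁f, e₂f, e₁e₁f, e₁e₂f, e₂e₂f)`. -/
def gradHess (f : ℝ → ℝ → ℝ) (θ φ : ℝ) : Fin 5 → ℝ :=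
  ![gradOne f θ φ, gradTwo f θ φ, hessOneOne f θ φ, hessOneTwo f θ φ, hessTwoTwo f θ φ]

/-- The vector `Y(x) = (Y₁(x), …, Y₅(x))` defined by
`(e₁f, e₂f, e₁e₁f, e₁e₂f, e₂e₂f)(x) = Λ_ℓ Y(x)`, for `f = f_ℓ`, `ℓ ≥ 2`. The index
`i : Fin 5` stands for `i + 1`. -/
def normVec (l : ℕ) (c : ℤ → ℂ) (θ φ : ℝ) : Fin 5 → ℝ :=
  Matrix.mulVec (cholFactor l)⁻¹ (gradHess (sphField l c) θ φ)

/-- The (probabilists') Hermite polynomial `H_2(x) = x² - 1`. -/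
def hermiteTwo (x : ℝ) : ℝ := Polynomial.aeval x (Polynomial.hermite 2)

/-- `A_{ij}(ℓ) = ∫_{S²} Y_i(x) Y_j(x) dx` (indices shifted by one). -/
def crossInt (l : ℕ) (c : ℤ → ℂ) (i j : Fin 5) : ℝ :=
  sphIntegral (fun θ φ => normVec l c θ φ i * normVec l c θ φ j)

/-- `B_i(ℓ) = ∫_{S²} H_2(Y_i(x)) dx` (index shifted by one). -/
def hermiteInt (l : ℕ) (c : ℤ → ℂ) (i : Fin 5) : ℝ :=
  sphIntegral (fun θ φ => hermiteTwo (normVec l c θ φ i))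

/-- The weighted sum `∑_{m=-ℓ}^{ℓ} {|c_m|² - 1} w(|m|)`. -/
def coeffSum (l : ℕ) (c : ℤ → ℂ) (w : ℝ → ℝ) : ℝ :=
  ∑ m ∈ Finset.Icc (-(l : ℤ)) (l : ℤ), (‖c m‖ ^ 2 - 1) * w |(m : ℝ)|

end

/-! Almost surely each of the six integrals is, exactly, a quadratic form that is diagonal in the
coefficients; the asymptotics come only from expanding its deterministic weights.

In coordinates, `f_ℓ` is a sum over `m` of `Re (b_m e^{imφ}) G_{|m|}(θ)` with `G_k = sin^k θ ·
P_ℓ^{(k)}(cos θ)`, `b_{-m}` conjugate to `b_m`, and `|b_m|² = |a_{ℓm}|² (ℓ-|m|)!/(ℓ+|m|)!`. Each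
component `Y_i` has the same shape, with another polar factor and with `b_m` or `i m b_m` as
coefficients. Parseval in `φ` (`sphIntegral_harmSum_mul`) removes all cross terms. What remains is
`4π ∑ |a_{ℓm}|² w(|m|)`, minus the area `4π` for the `B_i`.

The weights are `θ`-integrals of products of `G_k`, `G_k / sin` and their derivatives. Legendre's
equation, split into a raising and a lowering relation between `G_k` and `G_{k+1}`, makes suitable
combinations of these integrands exact derivatives whose boundary values at the poles are known.
This gives recurrences in `k` and closed forms: `normSqG_succ`, `ladder_boundary`, `intQR_eq`,
`sq_mul_normSqDQ`, `intDDGZ_eq`. After normalization they are explicit in `ℓ` and `k` (`modeJ`,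
`modeD`, `modeU`, `modeZ`).

The exact weights differ from the limit weights by `O(ℓ⁻²)` uniformly in `k ≤ ℓ`
(`exactWeight_bound`). The limit weights sum to `1 + O(1/ℓ)`, or to `O(1/ℓ)` for `A₃₅`
(`limitWeight_sum`), so the area term turns `|a|²` into `|a|² - 1`. The remainder is a sum of `2ℓ+1`
terms `(|a|² - 1) · O(ℓ⁻²)` plus a constant `O(1/ℓ)`; Cauchy–Schwarz and a uniform bound on the
second moments of `|a|² - 1` give `O(1/ℓ)` in mean square (`memLp_remainder`). -/

/-! ### Derivatives of the Legendre polynomials -/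

section Legendre

open Polynomial

/-- The `k`-th derivative of the Legendre polynomial `P_l`, as a function. -/
noncomputable def legendreDeriv (l k : ℕ) (x : ℝ) : ℝ :=
  (derivative^[k] (legendrePoly l)).eval x

theorem hasDerivAt_legendreDeriv (l k : ℕ) (x : ℝ) :
    HasDerivAt (legendreDeriv l k) (legendreDeriv l (k + 1) x) x := by
  have h := (derivative^[k] (legendrePoly l)).hasDerivAt x
  rw [← Function.iterate_succ_apply' derivative k] at h
  exact h

@[fun_prop]
theorem continuous_legendreDeriv (l k : ℕ) : Continuous (legendreDeriv l k) :=
  Polynomial.continuous _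

theorem legendreDeriv_eq (l k : ℕ) (x : ℝ) :
    legendreDeriv l k x = 1 / (2 ^ l * (l.factorial : ℝ)) *
      (derivative^[l + k] ((X ^ 2 - 1 : ℝ[X]) ^ l)).eval x := by
  rw [legendreDeriv, legendrePoly, iterate_derivative_C_mul, eval_mul, eval_C,
    ← Function.iterate_add_apply, add_comm k l]

/-- The function `U = (x² - 1)^l` solves `(x² - 1) U' = 2 l x U`; this is that equation
differentiated `n + 1` times. -/
theorem rodrigues_derivative_recurrence (l n : ℕ) :
    (X ^ 2 - 1 : ℝ[X]) * derivative^[n + 2] ((X ^ 2 - 1 : ℝ[X]) ^ l)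
      + C (2 * ((n : ℝ) + 1) - 2 * l) * X * derivative^[n + 1] ((X ^ 2 - 1 : ℝ[X]) ^ l)
      + C (((n : ℝ) + 1) * n - 2 * l * (n + 1)) * derivative^[n] ((X ^ 2 - 1 : ℝ[X]) ^ l) = 0 := by
  induction n with
  | zero =>
    have h0 : (X ^ 2 - 1 : ℝ[X]) * derivative ((X ^ 2 - 1 : ℝ[X]) ^ l)
        = C (2 * (l : ℝ)) * X * (X ^ 2 - 1 : ℝ[X]) ^ l := by
      cases l with
      | zero => simp
      | succ l =>
        simp only [derivative_pow, derivative_sub, derivative_X, derivative_one,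
          Nat.add_sub_cancel, map_mul, map_natCast, map_ofNat]
        push_cast
        ring
    generalize (X ^ 2 - 1 : ℝ[X]) ^ l = U at h0 ⊢
    have h1 := congrArg derivative h0
    simp only [derivative_mul, derivative_sub, derivative_pow, derivative_X, derivative_one,
      derivative_C] at h1
    simp only [Function.iterate_succ_apply', Function.iterate_zero_apply]
    simp only [map_sub, map_mul, map_add, map_zero, Nat.cast_zero,
      map_natCast, map_ofNat, map_one] at h1 ⊢
    norm_num at h1 ⊢
    linear_combination h1
  | succ n ih =>
    have h1 := congrArg derivative ih
    simp only [derivative_mul, derivative_sub, derivative_pow, derivative_X, derivative_one,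
      derivative_C, derivative_add, derivative_zero] at h1
    simp only [← Function.iterate_succ_apply' derivative] at h1
    simp only [map_sub, map_mul, map_add, map_natCast, map_ofNat, map_one, Nat.cast_add,
      Nat.cast_one] at h1 ⊢
    norm_num at h1 ⊢
    linear_combination h1

/-- The differential equation of the `k`-th derivative of `P_l`. -/
theorem legendreDeriv_ode (l k : ℕ) (x : ℝ) :
    (1 - x ^ 2) * legendreDeriv l (k + 2) x =
      2 * ((k : ℝ) + 1) * x * legendreDeriv l (k + 1) x
        - (sphEigenvalue l - k * (k + 1)) * legendreDeriv l k x := by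
  have h := congrArg (eval x) (rodrigues_derivative_recurrence l (l + k))
  simp only [eval_add, eval_mul, eval_sub, eval_pow, eval_X, eval_one, eval_C, eval_zero] at h
  rw [legendreDeriv_eq, legendreDeriv_eq, legendreDeriv_eq, sphEigenvalue, ← add_assoc,
    ← add_assoc]
  push_cast at h
  linear_combination (-(1 / (2 ^ l * (l.factorial : ℝ)))) * h

/-- In Leibniz' formula at `c`, only the term with all `l` derivatives on `(X - c)^l` survives. It
yields `P_l(±1)² = 1`; every boundary term below is a square, so the sign is never tracked. -/
theorem eval_iterate_derivative_mul_pow (l : ℕ) (c d : ℝ) :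
    (derivative^[l] ((X - C c) ^ l * (X - C d) ^ l)).eval c = l.factorial * (c - d) ^ l := by
  rw [iterate_derivative_mul, eval_finsetSum, Finset.sum_eq_single 0]
  · simp [iterate_derivative_X_sub_pow_self]
  · intro i hi hi0
    have : l - (l - i) ≠ 0 := by
      have := Finset.mem_range.1 hi
      omega
    simp [iterate_derivative_X_sub_pow, this]
  · simp

theorem legendreDeriv_zero_one_sq (l : ℕ) : legendreDeriv l 0 1 ^ 2 = 1 := by
  have h : (X ^ 2 - 1 : ℝ[X]) ^ l = (X - C 1) ^ l * (X - C (-1)) ^ l := by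
    rw [← mul_pow]; congr 1; simp; ring
  rw [legendreDeriv_eq, add_zero, h, eval_iterate_derivative_mul_pow,
    show (1 - -1 : ℝ) = 2 by norm_num]
  have h1 : (l.factorial : ℝ) ≠ 0 := by exact_mod_cast l.factorial_ne_zero
  calc _ = (1 : ℝ) ^ 2 := by congr 1; field_simp
    _ = 1 := one_pow 2

theorem legendreDeriv_zero_neg_one_sq (l : ℕ) : legendreDeriv l 0 (-1) ^ 2 = 1 := by
  have h : (X ^ 2 - 1 : ℝ[X]) ^ l = (X - C (-1)) ^ l * (X - C 1) ^ l := by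
    rw [← mul_pow]; congr 1; simp; ring
  rw [legendreDeriv_eq, add_zero, h, eval_iterate_derivative_mul_pow,
    show (-1 - 1 : ℝ) = -1 * 2 by norm_num, mul_pow (-1 : ℝ) 2]
  have h1 : (l.factorial : ℝ) ≠ 0 := by exact_mod_cast l.factorial_ne_zero
  have h2 : ((-1 : ℝ) ^ l) ^ 2 = 1 := by rw [← pow_mul, mul_comm, pow_mul]; norm_num
  calc _ = ((-1 : ℝ) ^ l) ^ 2 := by congr 1; field_simp
    _ = 1 := h2

/-- The leading coefficient `1 - x²` of Legendre's equation vanishes at the endpoint, which ties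
`P_l'` to `P_l` there. -/
theorem legendreDeriv_one_one_sq (l : ℕ) :
    legendreDeriv l 1 1 ^ 2 = (sphEigenvalue l / 2) ^ 2 := by
  have h := legendreDeriv_ode l 0 1
  norm_num at h
  have h2 : legendreDeriv l 1 1 = sphEigenvalue l / 2 * legendreDeriv l 0 1 := by linarith
  rw [h2, mul_pow, legendreDeriv_zero_one_sq, mul_one]

theorem legendreDeriv_one_neg_one_sq (l : ℕ) :
    legendreDeriv l 1 (-1) ^ 2 = (sphEigenvalue l / 2) ^ 2 := by
  have h := legendreDeriv_ode l 0 (-1)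
  norm_num at h
  have h2 : legendreDeriv l 1 (-1) = -(sphEigenvalue l / 2) * legendreDeriv l 0 (-1) := by
    linarith
  rw [h2, mul_pow, legendreDeriv_zero_neg_one_sq, mul_one, neg_sq]

theorem legendreDeriv_succ_self (l : ℕ) (x : ℝ) : legendreDeriv l (l + 1) x = 0 := by
  rw [legendreDeriv_eq, iterate_derivative_eq_zero, eval_zero, mul_zero]
  have h1 : ((X ^ 2 - 1 : ℝ[X]) ^ l).natDegree ≤ l * 2 :=
    natDegree_pow_le_of_le l (by compute_degree)
  omega

end Legendre

/-! ### The polar factors of the spherical harmonics -/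

section Polar

open Real

/-- `sin^k θ P_l^{(k)}(cos θ)`, the associated Legendre function up to sign. -/
noncomputable def polarG (l k : ℕ) (θ : ℝ) : ℝ := sin θ ^ k * legendreDeriv l k (cos θ)

/-- `polarG l k θ / sin θ`, for `1 ≤ k`. -/
noncomputable def polarQ (l k : ℕ) (θ : ℝ) : ℝ := sin θ ^ (k - 1) * legendreDeriv l k (cos θ)

/-- `polarG l k θ / sin² θ`, for `2 ≤ k`. -/
noncomputable def polarR (l k : ℕ) (θ : ℝ) : ℝ := sin θ ^ (k - 2) * legendreDeriv l k (cos θ)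

/-- The derivative of `polarG l k`. -/
noncomputable def polarDG (l k : ℕ) (θ : ℝ) : ℝ := k * cos θ * polarQ l k θ - polarG l (k + 1) θ

/-- The derivative of `polarQ l k`, for `1 ≤ k`. -/
noncomputable def polarDQ (l k : ℕ) (θ : ℝ) : ℝ :=
  ((k : ℝ) - 1) * cos θ * polarR l k θ - polarQ l (k + 1) θ

/-- The squared coefficient `(l - k) (l + k + 1)` of the ladder operators. -/
noncomputable def ladderSq (l k : ℕ) : ℝ := sphEigenvalue l - k * (k + 1)

/-- The second derivative of `polarG l k`. -/
noncomputable def polarDDG (l k : ℕ) (θ : ℝ) : ℝ :=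
  -(k * sin θ * polarQ l k θ) + k * cos θ * polarDQ l k θ - ladderSq l k * polarG l k θ
    + (k + 1) * cos θ * polarQ l (k + 1) θ

/-- The polar factor of the second covariant derivative in the direction of the longitude. -/
noncomputable def polarZ (l k : ℕ) (θ : ℝ) : ℝ :=
  -(sphEigenvalue l * polarG l k θ) - polarDDG l k θ

@[fun_prop] theorem continuous_polarG (l k : ℕ) : Continuous (polarG l k) := by
  unfold polarG; fun_prop

@[fun_prop] theorem continuous_polarQ (l k : ℕ) : Continuous (polarQ l k) := by
  unfold polarQ; fun_prop

@[fun_prop] theorem continuous_polarR (l k : ℕ) : Continuous (polarR l k) := by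
  unfold polarR; fun_prop

@[fun_prop] theorem continuous_polarDG (l k : ℕ) : Continuous (polarDG l k) := by
  unfold polarDG; fun_prop

@[fun_prop] theorem continuous_polarDQ (l k : ℕ) : Continuous (polarDQ l k) := by
  unfold polarDQ; fun_prop

@[fun_prop] theorem continuous_polarDDG (l k : ℕ) : Continuous (polarDDG l k) := by
  unfold polarDDG; fun_prop

@[fun_prop] theorem continuous_polarZ (l k : ℕ) : Continuous (polarZ l k) := by
  unfold polarZ; fun_prop

theorem sin_mul_polarQ_succ (l k : ℕ) (θ : ℝ) :
    sin θ * polarQ l (k + 1) θ = polarG l (k + 1) θ := by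
  simp only [polarQ, polarG, Nat.add_sub_cancel]; ring

/-- At `k = 0` the truncated exponent `k - 1` makes `polarQ` equal to `polarG` instead of its
quotient by `sin`. The factor `k` hides this value, and `polarQ` is used below only where such a
factor is present or the index is positive. -/
theorem mul_sin_mul_polarQ (l k : ℕ) (θ : ℝ) :
    (k : ℝ) * (sin θ * polarQ l k θ) = k * polarG l k θ := by
  cases k with
  | zero => simp
  | succ k => rw [sin_mul_polarQ_succ]

theorem sin_mul_polarR_add_two (l k : ℕ) (θ : ℝ) :
    sin θ * polarR l (k + 2) θ = polarQ l (k + 2) θ := by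
  simp only [polarQ, polarR, Nat.add_sub_cancel, show k + 2 - 1 = k + 1 by omega]; ring

theorem mul_sin_mul_polarR_succ (l k : ℕ) (θ : ℝ) :
    (k : ℝ) * (sin θ * polarR l (k + 1) θ) = k * polarQ l (k + 1) θ := by
  cases k with
  | zero => simp
  | succ k => rw [sin_mul_polarR_add_two]

theorem hasDerivAt_legendreDeriv_cos (l k : ℕ) (θ : ℝ) :
    HasDerivAt (fun t => legendreDeriv l k (cos t))
      (legendreDeriv l (k + 1) (cos θ) * -sin θ) θ :=
  (hasDerivAt_legendreDeriv l k (cos θ)).comp θ (hasDerivAt_cos θ)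

theorem hasDerivAt_polarG (l k : ℕ) (θ : ℝ) :
    HasDerivAt (polarG l k) (polarDG l k θ) θ := by
  refine (((hasDerivAt_sin θ).pow k).mul (hasDerivAt_legendreDeriv_cos l k θ)).congr_deriv ?_
  simp only [polarDG, polarG, polarQ, Pi.pow_apply]
  ring

/-- The lowering relation. The definition of `polarDG` is the raising one, `G_k' = k cot θ G_k -
G_{k+1}`; Legendre's equation trades it for an expression through `G_k` in place of `G_{k+2}`. -/
theorem polarDG_succ (l k : ℕ) (θ : ℝ) :
    polarDG l (k + 1) θ =
      ladderSq l k * polarG l k θ - (k + 1) * cos θ * polarQ l (k + 1) θ := by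
  have h := legendreDeriv_ode l k (cos θ)
  have hs : sin θ ^ 2 = 1 - cos θ ^ 2 := by rw [← Real.sin_sq_add_cos_sq θ]; ring
  simp only [polarDG, polarG, polarQ, ladderSq, Nat.add_sub_cancel, Nat.cast_add, Nat.cast_one,
    pow_succ (sin θ) (k + 1), pow_succ (sin θ) k]
  rw [← hs] at h
  linear_combination (-sin θ ^ k) * h

theorem hasDerivAt_polarQ_succ (l k : ℕ) (θ : ℝ) :
    HasDerivAt (polarQ l (k + 1)) (polarDQ l (k + 1) θ) θ := by
  refine (((hasDerivAt_sin θ).pow k).mul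
    (hasDerivAt_legendreDeriv_cos l (k + 1) θ)).congr_deriv ?_
  simp only [polarDQ, polarR, polarQ, Pi.pow_apply, Nat.cast_add, Nat.cast_one,
    show k + 1 - 2 = k - 1 by omega, Nat.add_sub_cancel]
  ring

/-- The lowering relation again, for `G_{k+2} / sin`. -/
theorem polarDQ_add_two (l k : ℕ) (θ : ℝ) :
    polarDQ l (k + 2) θ =
      ladderSq l (k + 1) * polarQ l (k + 1) θ - (k + 3) * cos θ * polarR l (k + 2) θ := by
  have h := legendreDeriv_ode l (k + 1) (cos θ)
  have hs : sin θ ^ 2 = 1 - cos θ ^ 2 := by rw [← Real.sin_sq_add_cos_sq θ]; ring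
  simp only [polarDQ, polarQ, polarR, ladderSq, Nat.add_sub_cancel, Nat.cast_add, Nat.cast_one,
    Nat.cast_ofNat, show k + 2 + 1 - 1 = k + 2 by omega,
    pow_succ (sin θ) (k + 1), pow_succ (sin θ) k] at h ⊢
  rw [← hs] at h
  linear_combination (-sin θ ^ k) * h

theorem hasDerivAt_polarDG (l k : ℕ) (θ : ℝ) :
    HasDerivAt (polarDG l k) (polarDDG l k θ) θ := by
  have h2 := hasDerivAt_polarG l (k + 1) θ
  rw [polarDG_succ] at h2
  cases k with
  | zero =>
    have h3 : polarDG l 0 = fun t => -polarG l 1 t := by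
      ext t; simp [polarDG]
    rw [h3]
    refine h2.neg.congr_deriv ?_
    simp [polarDDG]
    ring
  | succ k =>
    refine ((((hasDerivAt_cos θ).const_mul _).mul (hasDerivAt_polarQ_succ l k θ)).sub
      h2).congr_deriv ?_
    simp only [polarDDG]
    ring

/-- `polarZ` is defined through the trace of the Hessian, `Δf = -λ f`. This is Legendre's equation
in the form that identifies it with `cot θ G' - k² G / sin²`, the polar factor of `e₂e₂f`. -/
theorem sin_mul_polarZ (l k : ℕ) (θ : ℝ) :
    sin θ * polarZ l k θ = cos θ * polarDG l k θ - k ^ 2 * polarQ l k θ := by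
  have hs := Real.sin_sq_add_cos_sq θ
  have h1 := mul_sin_mul_polarQ l k θ
  have h2 := sin_mul_polarQ_succ l k θ
  have h3 : (k : ℝ) * (((k : ℝ) - 1) * (sin θ * polarR l k θ))
      = k * ((k - 1) * polarQ l k θ) := by
    cases k with
    | zero => simp
    | succ k =>
      have := mul_sin_mul_polarR_succ l k θ
      push_cast
      linear_combination ((k : ℝ) + 1) * this
  simp only [polarZ, polarDDG, polarDG, polarDQ, ladderSq]
  linear_combination (-cos θ ^ 2) * h3 - cos θ * h2
    + (sin θ * (k : ℝ) + sin θ) * h1 - (k * (k - 1) + k) * polarQ l k θ * hs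

end Polar

/-! ### Quadratic integrals of the polar factors -/

section PolarIntegrals

open Real

/-- The device behind all the closed forms: a primitive `F` whose derivative is a linear combination
of the wanted integrands gives a linear relation between their integrals. -/
theorem integral_two_of_hasDerivAt {F f g : ℝ → ℝ} (a b : ℝ)
    (h : ∀ θ, HasDerivAt F (a * f θ + b * g θ) θ) (hf : Continuous f) (hg : Continuous g) :
    a * (∫ θ in (0 : ℝ)..π, f θ) + b * (∫ θ in (0 : ℝ)..π, g θ) = F π - F 0 := by
  rw [← intervalIntegral.integral_eq_sub_of_hasDerivAt (fun θ _ => h θ)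
    ((by fun_prop : Continuous fun θ => a * f θ + b * g θ).intervalIntegrable _ _),
    intervalIntegral.integral_add ((hf.const_mul a).intervalIntegrable _ _)
      ((hg.const_mul b).intervalIntegrable _ _),
    intervalIntegral.integral_const_mul, intervalIntegral.integral_const_mul]

theorem integral_four_of_hasDerivAt {F f g p q : ℝ → ℝ} (a b c d : ℝ)
    (h : ∀ θ, HasDerivAt F (a * f θ + b * g θ + c * p θ + d * q θ) θ)
    (hf : Continuous f) (hg : Continuous g) (hp : Continuous p) (hq : Continuous q) :
    a * (∫ θ in (0 : ℝ)..π, f θ) + b * (∫ θ in (0 : ℝ)..π, g θ)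
      + c * (∫ θ in (0 : ℝ)..π, p θ) + d * (∫ θ in (0 : ℝ)..π, q θ) = F π - F 0 := by
  have h1 := integral_two_of_hasDerivAt (F := F) (f := fun θ => a * f θ + b * g θ)
    (g := fun θ => c * p θ + d * q θ) 1 1 (fun θ => (h θ).congr_deriv (by ring))
    (by fun_prop) (by fun_prop)
  rw [← h1, intervalIntegral.integral_add ((hf.const_mul a).intervalIntegrable _ _)
      ((hg.const_mul b).intervalIntegrable _ _),
    intervalIntegral.integral_add ((hp.const_mul c).intervalIntegrable _ _)
      ((hq.const_mul d).intervalIntegrable _ _)]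
  simp only [intervalIntegral.integral_const_mul]
  ring

theorem integral_three_of_hasDerivAt {F f g p : ℝ → ℝ} (a b c : ℝ)
    (h : ∀ θ, HasDerivAt F (a * f θ + b * g θ + c * p θ) θ)
    (hf : Continuous f) (hg : Continuous g) (hp : Continuous p) :
    a * (∫ θ in (0 : ℝ)..π, f θ) + b * (∫ θ in (0 : ℝ)..π, g θ)
      + c * (∫ θ in (0 : ℝ)..π, p θ) = F π - F 0 := by
  have h1 := integral_four_of_hasDerivAt (q := p) a b c 0 (fun θ => (h θ).congr_deriv (by ring))
    hf hg hp hp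
  linarith

theorem polarG_succ_zero (l k : ℕ) : polarG l (k + 1) 0 = 0 := by simp [polarG]
theorem polarG_succ_pi (l k : ℕ) : polarG l (k + 1) π = 0 := by simp [polarG]
theorem polarG_zero_zero_sq (l : ℕ) : polarG l 0 0 ^ 2 = 1 := by
  simp [polarG, legendreDeriv_zero_one_sq]
theorem polarG_zero_pi_sq (l : ℕ) : polarG l 0 π ^ 2 = 1 := by
  simp [polarG, legendreDeriv_zero_neg_one_sq]
theorem polarQ_add_two_zero (l k : ℕ) : polarQ l (k + 2) 0 = 0 := by simp [polarQ]
theorem polarQ_add_two_pi (l k : ℕ) : polarQ l (k + 2) π = 0 := by simp [polarQ]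
theorem polarQ_one_zero_sq (l : ℕ) : polarQ l 1 0 ^ 2 = (sphEigenvalue l / 2) ^ 2 := by
  simp [polarQ, legendreDeriv_one_one_sq]
theorem polarQ_one_pi_sq (l : ℕ) : polarQ l 1 π ^ 2 = (sphEigenvalue l / 2) ^ 2 := by
  simp [polarQ, legendreDeriv_one_neg_one_sq]

/-- The squared norm of `polarG l k`. -/
noncomputable def normSqG (l k : ℕ) : ℝ := ∫ θ in (0 : ℝ)..π, sin θ * polarG l k θ ^ 2

/-- The squared norm of `polarQ l k`. -/
noncomputable def normSqQ (l k : ℕ) : ℝ := ∫ θ in (0 : ℝ)..π, sin θ * polarQ l k θ ^ 2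

/-- The integral of `polarG l k ^ 2 / sin ^ 3`, for `2 ≤ k`. -/
noncomputable def intQR (l k : ℕ) : ℝ := ∫ θ in (0 : ℝ)..π, polarQ l k θ * polarR l k θ

/-- The raising and lowering operators are adjoint: both sides come from differentiating `sin θ G_k
G_{k+1}`, which vanishes at the poles. -/
theorem normSqG_succ (l k : ℕ) : normSqG l (k + 1) = ladderSq l k * normSqG l k := by
  have h := integral_two_of_hasDerivAt
    (F := fun θ => sin θ * (polarG l k θ * polarG l (k + 1) θ))
    (f := fun θ => sin θ * polarG l k θ ^ 2) (g := fun θ => sin θ * polarG l (k + 1) θ ^ 2)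
    (ladderSq l k) (-1) (fun θ => by
      refine ((hasDerivAt_sin θ).mul ((hasDerivAt_polarG l k θ).mul
        (hasDerivAt_polarG l (k + 1) θ))).congr_deriv ?_
      have h1 := mul_sin_mul_polarQ l k θ
      have h2 := sin_mul_polarQ_succ l k θ
      rw [polarDG_succ, polarDG, Pi.mul_apply]
      linear_combination cos θ * polarG l (k + 1) θ * h1
        - ((k : ℝ) + 1) * cos θ * polarG l k θ * h2)
    (by fun_prop) (by fun_prop)
  simp only [sin_pi, sin_zero, zero_mul, sub_zero] at h
  simp only [normSqG]
  linarith

/-- The primitive is `cos θ ((l-k)(l+k+1) G_k² + G_{k+1}²)`. Its boundary values vanish for `k ≥ 1`,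
leaving a recurrence for the integrals of `G_k² / sin`; for `k = 0` they are given by `P_l(±1)²` and
start that recurrence. -/
theorem ladder_boundary (l k : ℕ) :
    2 * ladderSq l k * (∫ θ in (0 : ℝ)..π, k * (polarQ l k θ * polarG l k θ))
      - 2 * (k + 1) * normSqQ l (k + 1) =
    -(ladderSq l k * polarG l k π ^ 2) - ladderSq l k * polarG l k 0 ^ 2 := by
  have h := integral_four_of_hasDerivAt
    (F := fun θ => cos θ * (ladderSq l k * polarG l k θ ^ 2 + polarG l (k + 1) θ ^ 2))
    (f := fun θ => k * (polarQ l k θ * polarG l k θ))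
    (g := fun θ => sin θ * polarQ l (k + 1) θ ^ 2)
    (p := fun θ => sin θ * polarG l k θ ^ 2) (q := fun θ => sin θ * polarG l (k + 1) θ ^ 2)
    (2 * ladderSq l k) (-(2 * (k + 1))) (-((2 * k + 1) * ladderSq l k)) (2 * k + 1) (fun θ => by
      refine ((hasDerivAt_cos θ).mul ((((hasDerivAt_polarG l k θ).pow 2).const_mul _).add
        ((hasDerivAt_polarG l (k + 1) θ).pow 2))).congr_deriv ?_
      have h1 := mul_sin_mul_polarQ l k θ
      have h2 := sin_mul_polarQ_succ l k θ
      have hs := sin_sq_add_cos_sq θ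
      rw [polarDG_succ, polarDG]
      simp only [Pi.pow_apply, Nat.cast_ofNat, Nat.add_one_sub_one, pow_one, Pi.add_apply]
      linear_combination (2 * ladderSq l k * k * polarQ l k θ * polarG l k θ
          - 2 * (k + 1) * polarQ l (k + 1) θ * polarG l (k + 1) θ) * hs
        + 2 * (k + 1) * (polarQ l (k + 1) θ + sin θ * polarG l (k + 1) θ) * h2
        - 2 * ladderSq l k * sin θ * polarG l k θ * h1)
    (by fun_prop) (by fun_prop) (by fun_prop) (by fun_prop)
  have h3 := normSqG_succ l k
  simp only [polarG_succ_pi, polarG_succ_zero, cos_pi, cos_zero] at h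
  simp only [normSqG, normSqQ] at h3 ⊢
  linear_combination h - (2 * (k : ℝ) + 1) * h3

theorem normSqQ_one (l : ℕ) : normSqQ l 1 = sphEigenvalue l := by
  have h := ladder_boundary l 0
  rw [polarG_zero_pi_sq, polarG_zero_zero_sq] at h
  simp [ladderSq] at h
  linarith

theorem integral_polarQ_mul_polarG_succ (l k : ℕ) :
    (∫ θ in (0 : ℝ)..π, ((k + 1 : ℕ) : ℝ) * (polarQ l (k + 1) θ * polarG l (k + 1) θ)) =
      (k + 1) * normSqQ l (k + 1) := by
  rw [normSqQ, ← intervalIntegral.integral_const_mul]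
  congr 1; ext θ
  rw [← sin_mul_polarQ_succ]; push_cast; ring

theorem normSqQ_add_two (l k : ℕ) :
    (k + 2) * normSqQ l (k + 2) = ladderSq l (k + 1) * ((k + 1) * normSqQ l (k + 1)) := by
  have h := ladder_boundary l (k + 1)
  rw [polarG_succ_pi, polarG_succ_zero, integral_polarQ_mul_polarG_succ] at h
  push_cast at h
  linarith

/-- The integral of `k * polarG l k ^ 2 / sin`, which is the inverse of the squared
normalization of `polarG l k`. -/
noncomputable def invNormSq (l k : ℕ) : ℝ := k * normSqQ l k

theorem invNormSq_one (l : ℕ) : invNormSq l 1 = sphEigenvalue l := by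
  simp [invNormSq, normSqQ_one]

theorem invNormSq_add_two (l k : ℕ) :
    invNormSq l (k + 2) = ladderSq l (k + 1) * invNormSq l (k + 1) := by
  have := normSqQ_add_two l k
  simp only [invNormSq]; push_cast; linarith

/-- For the top mode `k = l` the raising relation loses its second term, since `G_{l+1} = 0`. This
links the two families of integrals, so the value of `∫ sin G_k²` is found at the top mode and
carried down the ladder. -/
theorem normSqG_self (k : ℕ) :
    (2 * ((k : ℝ) + 1) + 1) * normSqG (k + 1) (k + 1) = 2 * invNormSq (k + 1) (k + 1) := by
  have h := integral_two_of_hasDerivAt (F := fun θ => cos θ * polarG (k + 1) (k + 1) θ ^ 2)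
    (f := fun θ => sin θ * polarG (k + 1) (k + 1) θ ^ 2)
    (g := fun θ => ((k + 1 : ℕ) : ℝ) * (polarQ (k + 1) (k + 1) θ * polarG (k + 1) (k + 1) θ))
    (-(2 * (k + 1) + 1)) 2 (fun θ => by
      refine ((hasDerivAt_cos θ).mul ((hasDerivAt_polarG _ _ θ).pow 2)).congr_deriv ?_
      have h0 : polarG (k + 1) (k + 1 + 1) θ = 0 := by
        simp [polarG, legendreDeriv_succ_self]
      have h1 := sin_mul_polarQ_succ (k + 1) k θ
      have hs := sin_sq_add_cos_sq θ
      rw [polarDG, h0]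
      push_cast
      simp only [Pi.pow_apply, pow_one]
      linear_combination
        2 * ((k : ℝ) + 1) * polarQ (k + 1) (k + 1) θ * polarG (k + 1) (k + 1) θ * hs
        - 2 * ((k : ℝ) + 1) * sin θ * polarG (k + 1) (k + 1) θ * h1)
    (by fun_prop) (by fun_prop)
  rw [integral_polarQ_mul_polarG_succ, polarG_succ_pi, polarG_succ_zero] at h
  simp only [normSqG, invNormSq]
  push_cast
  linarith

/-- The same primitive as in `ladder_boundary`, with `G / sin` in place of `G`. Only `k = 0` has a
boundary term, from `P_l'(±1)² = (λ/2)²`. -/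
theorem intQR_boundary (l k : ℕ) :
    2 * ladderSq l (k + 1) * (k * intQR l (k + 1)) - 2 * (k + 3) * intQR l (k + 2)
      - (2 * k + 1) * ladderSq l (k + 1) * normSqQ l (k + 1)
      + (2 * k + 5) * normSqQ l (k + 2) =
    -(ladderSq l (k + 1) * polarQ l (k + 1) π ^ 2)
      - ladderSq l (k + 1) * polarQ l (k + 1) 0 ^ 2 := by
  have h := integral_four_of_hasDerivAt
    (F := fun θ => cos θ *
      (ladderSq l (k + 1) * polarQ l (k + 1) θ ^ 2 + polarQ l (k + 2) θ ^ 2))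
    (f := fun θ => polarQ l (k + 1) θ * polarR l (k + 1) θ)
    (g := fun θ => polarQ l (k + 2) θ * polarR l (k + 2) θ)
    (p := fun θ => sin θ * polarQ l (k + 1) θ ^ 2)
    (q := fun θ => sin θ * polarQ l (k + 2) θ ^ 2)
    (2 * ladderSq l (k + 1) * k) (-(2 * (k + 3)))
    (-((2 * k + 1) * ladderSq l (k + 1))) (2 * k + 5) (fun θ => by
      refine ((hasDerivAt_cos θ).mul ((((hasDerivAt_polarQ_succ l k θ).pow 2).const_mul _).add
        ((hasDerivAt_polarQ_succ l (k + 1) θ).pow 2))).congr_deriv ?_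
      have h1 := mul_sin_mul_polarR_succ l k θ
      have h2 := sin_mul_polarR_add_two l k θ
      have hs := sin_sq_add_cos_sq θ
      rw [polarDQ_add_two, polarDQ]
      push_cast
      simp only [Pi.pow_apply, pow_one, Pi.add_apply]
      linear_combination
        (2 * ladderSq l (k + 1) * k * polarQ l (k + 1) θ * polarR l (k + 1) θ
          - 2 * (k + 3) * polarQ l (k + 2) θ * polarR l (k + 2) θ) * hs
        + 2 * (k + 3) * (sin θ * polarQ l (k + 2) θ) * h2
        - 2 * ladderSq l (k + 1) * sin θ * polarQ l (k + 1) θ * h1)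
    (by fun_prop) (by fun_prop) (by fun_prop) (by fun_prop)
  simp only [polarQ_add_two_pi, polarQ_add_two_zero, cos_pi, cos_zero] at h
  simp only [intQR, normSqQ]
  linear_combination h

/-- With `j = k + 2`, the closed form is `j (j² - 1) ∫ G_j² / sin³ = (λ - 1 + j²)/2 · j ∫ G_j² /
sin`. It solves the recurrence `intQR_boundary`, whose first step is fixed by the pole values of
`Q_1`. -/
theorem intQR_eq (l k : ℕ) :
    ((k : ℝ) + 1) * (k + 2) * (k + 3) * intQR l (k + 2) =
      (sphEigenvalue l - 1 + (k + 2) ^ 2) / 2 * invNormSq l (k + 2) := by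
  induction k with
  | zero =>
    have h := intQR_boundary l 0
    have h2 := normSqQ_add_two l 0
    rw [polarQ_one_zero_sq, polarQ_one_pi_sq] at h
    simp only [zero_add, normSqQ_one, Nat.cast_zero, invNormSq, ladderSq] at h h2 ⊢
    push_cast at h h2 ⊢
    linear_combination (-1) * h + (5 / 2 - (sphEigenvalue l + 3) / 2) * h2
  | succ k ih =>
    have h := intQR_boundary l (k + 1)
    have h2 := normSqQ_add_two l (k + 1)
    rw [polarQ_add_two_zero, polarQ_add_two_pi] at h
    simp only [add_assoc, Nat.reduceAdd] at h h2
    simp only [invNormSq, add_assoc, Nat.reduceAdd] at ih ⊢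
    push_cast at h h2 ih ⊢
    linear_combination (-(((k : ℝ) + 2) * (k + 3) / 2)) * h + ladderSq l (k + 2) * ih
      + (((k : ℝ) + 2) * (2 * k + 7) / 2 - (sphEigenvalue l - 1 + (k + 3) ^ 2) / 2) * h2

end PolarIntegrals

/-! ### Integrals of first and second derivatives of the polar factors. -/

section PolarSecondOrder

open Real

theorem polarDG_succ_eq (l k : ℕ) (θ : ℝ) :
    polarDG l (k + 1) θ = cos θ * polarQ l (k + 1) θ + sin θ * polarDQ l (k + 1) θ := by
  have h1 := mul_sin_mul_polarR_succ l k θ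
  have h2 := sin_mul_polarQ_succ l (k + 1) θ
  rw [polarDG, polarDQ]
  push_cast
  linear_combination h2 - cos θ * h1

theorem normSqDQ_succ (l k : ℕ) :
    (∫ θ in (0 : ℝ)..π, sin θ * polarDQ l (k + 1) θ ^ 2) =
      k * (k + 1) * normSqQ l (k + 1) + normSqQ l (k + 2) - k ^ 2 * intQR l (k + 1) := by
  have h := integral_four_of_hasDerivAt
    (F := fun θ => k * (cos θ * polarQ l (k + 1) θ ^ 2))
    (f := fun θ => sin θ * polarDQ l (k + 1) θ ^ 2)
    (g := fun θ => polarQ l (k + 1) θ * polarR l (k + 1) θ)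
    (p := fun θ => sin θ * polarQ l (k + 1) θ ^ 2)
    (q := fun θ => sin θ * polarQ l (k + 2) θ ^ 2)
    1 (k ^ 2) (-(k * (k + 1))) (-1) (fun θ => by
      refine (((hasDerivAt_cos θ).mul ((hasDerivAt_polarQ_succ l k θ).pow 2)).const_mul
        (k : ℝ)).congr_deriv ?_
      have h1 := mul_sin_mul_polarR_succ l k θ
      have hs := sin_sq_add_cos_sq θ
      rw [polarDQ]
      push_cast
      simp only [Pi.pow_apply]
      linear_combination (-(k : ℝ) * cos θ ^ 2 * polarR l (k + 1) θ
          + 2 * cos θ * polarQ l (k + 2) θ - k * sin θ * polarQ l (k + 1) θ) * h1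
        + (k : ℝ) ^ 2 * polarR l (k + 1) θ * polarQ l (k + 1) θ * hs)
    (by fun_prop) (by fun_prop) (by fun_prop) (by fun_prop)
  -- `Q_1` does not vanish at the poles, but then the factor `k` is `0`; for larger indices `Q`
  -- itself vanishes there.
  have hb : (k : ℝ) * (cos π * polarQ l (k + 1) π ^ 2)
      - k * (cos 0 * polarQ l (k + 1) 0 ^ 2) = 0 := by
    cases k with
    | zero => simp
    | succ k => rw [polarQ_add_two_pi, polarQ_add_two_zero]; ring
  rw [hb] at h
  simp only [normSqQ, intQR]
  linear_combination h

/-- Inserts the closed form of `intQR` into `normSqDQ_succ`. For the mode `1` that integral, for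
which there is no closed form, has coefficient `0`, so the modes `0`, `1` and `≥ 2` are separate. -/
theorem sq_mul_normSqDQ (l k : ℕ) :
    (k : ℝ) ^ 2 * (∫ θ in (0 : ℝ)..π, sin θ * polarDQ l k θ ^ 2) =
      k * (sphEigenvalue l - 1 - k ^ 2) / 2 * invNormSq l k := by
  rcases k with _ | _ | k
  · simp
  · have h2 := normSqQ_add_two l 0
    rw [normSqDQ_succ]
    simp only [zero_add, invNormSq, ladderSq] at h2 ⊢
    push_cast at h2 ⊢
    linear_combination h2 / 2
  · have h1 := intQR_eq l k
    have h2 := normSqQ_add_two l (k + 1)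
    have h3 : ((k : ℝ) + 3) ≠ 0 := by positivity
    rw [normSqDQ_succ]
    simp only [add_assoc, Nat.reduceAdd] at h2
    simp only [invNormSq, ladderSq, add_assoc, Nat.reduceAdd] at h1 h2 ⊢
    push_cast at h1 h2 ⊢
    apply mul_left_cancel₀ h3
    linear_combination ((k : ℝ) + 2) ^ 2 * h2 - ((k : ℝ) + 2) * (k + 1) * h1

/-- The squared norm of the derivative of `polarG l k`. -/
noncomputable def normSqDG (l k : ℕ) : ℝ := ∫ θ in (0 : ℝ)..π, sin θ * polarDG l k θ ^ 2

/-- Integration by parts, with Legendre's equation for `(sin θ G')'`. -/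
theorem normSqDG_eq (l k : ℕ) :
    normSqDG l k = sphEigenvalue l * normSqG l k - k * invNormSq l k := by
  have h := integral_three_of_hasDerivAt
    (F := fun θ => sin θ * (polarG l k θ * polarDG l k θ))
    (f := fun θ => sin θ * polarDG l k θ ^ 2) (g := fun θ => sin θ * polarG l k θ ^ 2)
    (p := fun θ => sin θ * polarQ l k θ ^ 2) 1 (-sphEigenvalue l) (k ^ 2) (fun θ => by
      refine ((hasDerivAt_sin θ).mul ((hasDerivAt_polarG l k θ).mul
        (hasDerivAt_polarDG l k θ))).congr_deriv ?_
      have h1 := mul_sin_mul_polarQ l k θ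
      have h2 := sin_mul_polarZ l k θ
      rw [polarZ] at h2
      rw [Pi.mul_apply]
      linear_combination (-polarG l k θ) * h2 - (k * polarQ l k θ) * h1)
    (by fun_prop) (by fun_prop) (by fun_prop)
  simp only [sin_pi, sin_zero, zero_mul, sub_zero] at h
  simp only [normSqDG, normSqG, invNormSq, normSqQ]
  linear_combination h

/-- The integral of `polarG l k` against its second derivative. -/
noncomputable def intGDDG (l k : ℕ) : ℝ :=
  ∫ θ in (0 : ℝ)..π, sin θ * (polarG l k θ * polarDDG l k θ)

/-- Two integrations by parts. The extra `1` is the pole contribution of the zonal mode `k = 0`, the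
only one that does not vanish at the poles; it is the source of the `if k = 0` terms in `modeU` and
`modeZ`. -/
theorem intGDDG_eq (l k : ℕ) :
    intGDDG l k = -normSqDG l k - normSqG l k / 2 + if k = 0 then 1 else 0 := by
  have h := integral_three_of_hasDerivAt
    (F := fun θ => sin θ * (polarG l k θ * polarDG l k θ) - cos θ * polarG l k θ ^ 2 / 2)
    (f := fun θ => sin θ * polarDG l k θ ^ 2) (g := fun θ => sin θ * polarG l k θ ^ 2)
    (p := fun θ => sin θ * (polarG l k θ * polarDDG l k θ)) 1 (1 / 2) 1 (fun θ => by
      refine (((hasDerivAt_sin θ).mul ((hasDerivAt_polarG l k θ).mul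
        (hasDerivAt_polarDG l k θ))).sub (((hasDerivAt_cos θ).mul
          ((hasDerivAt_polarG l k θ).pow 2)).div_const 2)).congr_deriv ?_
      simp only [Pi.mul_apply, Pi.pow_apply]
      ring)
    (by fun_prop) (by fun_prop) (by fun_prop)
  have hb : polarG l k π ^ 2 + polarG l k 0 ^ 2 = if k = 0 then 2 else 0 := by
    cases k with
    | zero => rw [polarG_zero_pi_sq, polarG_zero_zero_sq]; norm_num
    | succ k => rw [polarG_succ_pi, polarG_succ_zero]; simp
  simp only [sin_pi, sin_zero, cos_pi, cos_zero] at h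
  simp only [intGDDG, normSqDG, normSqG]
  split_ifs at hb ⊢ <;> linear_combination h + hb / 2

/-- The integral of the product of the two diagonal polar factors of the Hessian. -/
noncomputable def intDDGZ (l k : ℕ) : ℝ :=
  ∫ θ in (0 : ℝ)..π, sin θ * (polarDDG l k θ * polarZ l k θ)

/-- The first step is, mode by mode, the identity `∫ det ∇²f = ½ ∫ |∇f|²` on the unit sphere: the
product of the diagonal entries exceeds the square of the mixed entry by half the gradient. -/
theorem intDDGZ_eq (l k : ℕ) :
    intDDGZ l k = k * (sphEigenvalue l - 1 - k ^ 2) / 2 * invNormSq l k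
      + sphEigenvalue l * normSqG l k / 2 := by
  suffices h : intDDGZ l k = (k : ℝ) ^ 2 * (∫ θ in (0 : ℝ)..π, sin θ * polarDQ l k θ ^ 2)
      + normSqDG l k / 2 + (k : ℝ) ^ 2 * normSqQ l k / 2 by
    rw [h, normSqDG_eq, sq_mul_normSqDQ, invNormSq]; ring
  rcases k with _ | k
  · have h := integral_two_of_hasDerivAt (F := fun θ => cos θ * polarDG l 0 θ ^ 2 / 2)
      (f := fun θ => sin θ * (polarDDG l 0 θ * polarZ l 0 θ))
      (g := fun θ => sin θ * polarDG l 0 θ ^ 2) 1 (-1 / 2) (fun θ => by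
        refine (((hasDerivAt_cos θ).mul ((hasDerivAt_polarDG l 0 θ).pow 2)).div_const
          2).congr_deriv ?_
        have h2 := sin_mul_polarZ l 0 θ
        simp only [Pi.pow_apply]
        push_cast at h2 ⊢
        linear_combination (-polarDDG l 0 θ) * h2)
      (by fun_prop) (by fun_prop)
    have h0 : ∀ θ, polarDG l 0 θ = -polarG l 1 θ := fun θ => by simp [polarDG]
    rw [h0 π, h0 0, polarG_succ_pi, polarG_succ_zero] at h
    simp only [intDDGZ, normSqDG]
    push_cast
    linear_combination h
  · have h := integral_four_of_hasDerivAt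
      (F := fun θ => cos θ * polarDG l (k + 1) θ ^ 2 / 2
        - ((k : ℝ) + 1) ^ 2 * (polarQ l (k + 1) θ * polarDG l (k + 1) θ)
        + ((k : ℝ) + 1) ^ 2 * (cos θ * polarQ l (k + 1) θ ^ 2) / 2)
      (f := fun θ => sin θ * (polarDDG l (k + 1) θ * polarZ l (k + 1) θ))
      (g := fun θ => sin θ * polarDG l (k + 1) θ ^ 2)
      (p := fun θ => sin θ * polarDQ l (k + 1) θ ^ 2)
      (q := fun θ => sin θ * polarQ l (k + 1) θ ^ 2)
      1 (-1 / 2) (-((k : ℝ) + 1) ^ 2) (-((k : ℝ) + 1) ^ 2 / 2) (fun θ => by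
        refine (((((hasDerivAt_cos θ).mul ((hasDerivAt_polarDG l (k + 1) θ).pow 2)).div_const
          2).sub (((hasDerivAt_polarQ_succ l k θ).mul (hasDerivAt_polarDG l (k + 1) θ)).const_mul
          _)).add ((((hasDerivAt_cos θ).mul ((hasDerivAt_polarQ_succ l k θ).pow 2)).const_mul
          _).div_const 2)).congr_deriv ?_
        have h2 := sin_mul_polarZ l (k + 1) θ
        have h3 := polarDG_succ_eq l k θ
        simp only [Pi.pow_apply]
        push_cast at h2 ⊢
        linear_combination (-polarDDG l (k + 1) θ) * h2
          - ((k : ℝ) + 1) ^ 2 * polarDQ l (k + 1) θ * h3)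
      (by fun_prop) (by fun_prop) (by fun_prop) (by fun_prop)
    -- At a pole `G' = cos θ · Q` and `cos² θ = 1`, so the primitive reduces to `-k (k + 2) cos θ Q²
    -- / 2`; either `k = 0` or `Q` vanishes.
    have hb : ∀ θ, ((k : ℝ) * polarQ l (k + 1) θ = 0) → sin θ = 0 →
        cos θ * polarDG l (k + 1) θ ^ 2 / 2
        - ((k : ℝ) + 1) ^ 2 * (polarQ l (k + 1) θ * polarDG l (k + 1) θ)
        + ((k : ℝ) + 1) ^ 2 * (cos θ * polarQ l (k + 1) θ ^ 2) / 2 = 0 := by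
      intro θ hq hs
      have hc := sin_sq_add_cos_sq θ
      rw [polarDG_succ_eq, hs]
      rw [hs] at hc
      linear_combination polarQ l (k + 1) θ ^ 2 * cos θ / 2 * hc
        - ((k : ℝ) + 2) * polarQ l (k + 1) θ * cos θ / 2 * hq
    rw [hb π (by cases k with
        | zero => simp
        | succ k => rw [polarQ_add_two_pi]; simp) sin_pi,
      hb 0 (by cases k with
        | zero => simp
        | succ k => rw [polarQ_add_two_zero]; simp) sin_zero] at h
    simp only [intDDGZ, normSqDG, normSqQ]
    push_cast
    linear_combination h

/-- Multiply the trace identity `G'' + Z = -λ G` by `G''`; `normSqZ_add` multiplies it by `Z`. Both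
squared norms thus follow from the mixed integral `intDDGZ`. -/
theorem normSqDDG_add (l k : ℕ) :
    (∫ θ in (0 : ℝ)..π, sin θ * polarDDG l k θ ^ 2) + intDDGZ l k =
      -(sphEigenvalue l * intGDDG l k) := by
  rw [intDDGZ, intGDDG, ← intervalIntegral.integral_add
    (Continuous.intervalIntegrable (by fun_prop) _ _)
    (Continuous.intervalIntegrable (by fun_prop) _ _), ← intervalIntegral.integral_const_mul,
    ← intervalIntegral.integral_neg]
  congr 1; ext θ
  rw [polarZ]; ring

theorem normSqZ_add (l k : ℕ) :
    (∫ θ in (0 : ℝ)..π, sin θ * polarZ l k θ ^ 2) + intDDGZ l k =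
      sphEigenvalue l ^ 2 * normSqG l k + sphEigenvalue l * intGDDG l k := by
  rw [intDDGZ, intGDDG, normSqG, ← intervalIntegral.integral_add
    (Continuous.intervalIntegrable (by fun_prop) _ _)
    (Continuous.intervalIntegrable (by fun_prop) _ _), ← intervalIntegral.integral_const_mul,
    ← intervalIntegral.integral_const_mul, ← intervalIntegral.integral_add
    (Continuous.intervalIntegrable (by fun_prop) _ _)
    (Continuous.intervalIntegrable (by fun_prop) _ _)]
  congr 1; ext θ
  rw [polarZ]; ring

/-! ### Normalized closed forms, explicit in the degree and the mode. -/

/-- The squared normalization of the associated Legendre functions. -/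
noncomputable def normFactor (l k : ℕ) : ℝ := ((l - k).factorial : ℝ) / (l + k).factorial

theorem normFactor_nonneg (l k : ℕ) : 0 ≤ normFactor l k := by unfold normFactor; positivity

theorem normFactor_zero (l : ℕ) : normFactor l 0 = 1 := by
  have : (l.factorial : ℝ) ≠ 0 := by exact_mod_cast l.factorial_ne_zero
  simp [normFactor, this]

theorem normFactor_eq_ladderSq_mul {l k : ℕ} (h : k + 1 ≤ l) :
    normFactor l k = ladderSq l k * normFactor l (k + 1) := by
  obtain ⟨j, rfl⟩ := Nat.exists_eq_add_of_le h
  have h1 : k + 1 + j - k = j + 1 := by omega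
  have h2 : k + 1 + j - (k + 1) = j := by omega
  have h3 : k + 1 + j + (k + 1) = (k + 1 + j + k) + 1 := by omega
  rw [normFactor, normFactor, h1, h2, h3, Nat.factorial_succ, Nat.factorial_succ, ladderSq,
    sphEigenvalue]
  have : (((k + 1 + j + k).factorial : ℕ) : ℝ) ≠ 0 := by
    exact_mod_cast Nat.factorial_ne_zero _
  have h4 : ((k : ℝ) + 1 + j + k + 1) ≠ 0 := by positivity
  push_cast
  field_simp
  ring

/-- Both factors move along the ladder by inverse ratios, so the product is constant in the mode. -/
theorem normFactor_mul_invNormSq {l k : ℕ} (h : k + 1 ≤ l) :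
    normFactor l (k + 1) * invNormSq l (k + 1) = 1 := by
  induction k with
  | zero =>
    have h1 := normFactor_eq_ladderSq_mul h
    rw [normFactor_zero] at h1
    rw [invNormSq_one, h1, ladderSq]
    push_cast; ring
  | succ k ih =>
    rw [invNormSq_add_two, ← ih (by omega), normFactor_eq_ladderSq_mul h]
    ring

/-- The product is constant along the ladder; its value is read off at `k = l` from `normSqG_self`.
-/
theorem normFactor_mul_normSqG {l k : ℕ} (hl : 1 ≤ l) (h : k ≤ l) :
    normFactor l k * normSqG l k = 2 / (2 * l + 1) := by
  have h0 : ∀ k, k ≤ l → normFactor l k * normSqG l k = normSqG l 0 := by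
    intro k hk
    induction k with
    | zero => rw [normFactor_zero, one_mul]
    | succ k ih =>
      rw [← ih (by omega), normFactor_eq_ladderSq_mul hk, normSqG_succ]
      ring
  rw [h0 k h, ← h0 l le_rfl]
  obtain ⟨j, rfl⟩ := Nat.exists_eq_add_of_le' hl
  have h1 := normSqG_self j
  have h2 := normFactor_mul_invNormSq (le_refl (j + 1))
  push_cast
  rw [eq_div_iff (by positivity)]
  linear_combination normFactor (j + 1) (j + 1) * h1 + 2 * h2

theorem mul_normFactor_mul_invNormSq {l k : ℕ} (h : k ≤ l) :
    (k : ℝ) * (normFactor l k * invNormSq l k) = k := by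
  cases k with
  | zero => simp
  | succ k => rw [normFactor_mul_invNormSq h, mul_one]

/-- The mean square of the mode `k` in the mixed component of the Hessian. -/
noncomputable def modeJ (l k : ℕ) : ℝ := k * (sphEigenvalue l - 1 - k ^ 2) / 2

/-- The contribution of the mode `k` to the product of the diagonal components of the
Hessian. -/
noncomputable def modeD (l k : ℕ) : ℝ := sphEigenvalue l / (2 * l + 1) + modeJ l k

/-- The mean square of the mode `k` in the first diagonal component of the Hessian. -/
noncomputable def modeU (l k : ℕ) : ℝ :=
  sphEigenvalue l * ((2 * sphEigenvalue l + 1) / (2 * l + 1) - k - if k = 0 then 1 else 0)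
    - modeD l k

/-- The mean square of the mode `k` in the second diagonal component of the Hessian. -/
noncomputable def modeZ (l k : ℕ) : ℝ :=
  sphEigenvalue l * ((k : ℝ) + if k = 0 then 1 else 0) - 2 * sphEigenvalue l / (2 * l + 1)
    - modeJ l k

variable {l k : ℕ}

theorem normFactor_mul_normSqDG (hl : 1 ≤ l) (h : k ≤ l) :
    normFactor l k * (∫ θ in (0 : ℝ)..π, sin θ * polarDG l k θ ^ 2) =
      2 * sphEigenvalue l / (2 * l + 1) - k := by
  have h1 := normSqDG_eq l k
  have h2 := normFactor_mul_normSqG hl h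
  have h3 := mul_normFactor_mul_invNormSq h
  rw [normSqDG] at h1
  linear_combination normFactor l k * h1 + sphEigenvalue l * h2 - h3

theorem normFactor_mul_normSqQ (h : k ≤ l) :
    normFactor l k * ((k : ℝ) ^ 2 * ∫ θ in (0 : ℝ)..π, sin θ * polarQ l k θ ^ 2) = k := by
  have h3 := mul_normFactor_mul_invNormSq h
  rw [invNormSq, normSqQ] at h3
  linear_combination h3

theorem normFactor_mul_normSqDQ (h : k ≤ l) :
    normFactor l k * ((k : ℝ) ^ 2 * ∫ θ in (0 : ℝ)..π, sin θ * polarDQ l k θ ^ 2) =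
      modeJ l k := by
  have h3 := mul_normFactor_mul_invNormSq h
  rw [sq_mul_normSqDQ, modeJ]
  linear_combination (sphEigenvalue l - 1 - (k : ℝ) ^ 2) / 2 * h3

theorem normFactor_mul_intDDGZ (hl : 1 ≤ l) (h : k ≤ l) :
    normFactor l k * (∫ θ in (0 : ℝ)..π, sin θ * (polarDDG l k θ * polarZ l k θ)) =
      modeD l k := by
  have h1 := intDDGZ_eq l k
  have h2 := normFactor_mul_normSqG hl h
  have h3 := mul_normFactor_mul_invNormSq h
  rw [intDDGZ] at h1
  rw [modeD, modeJ]
  linear_combination normFactor l k * h1 + sphEigenvalue l / 2 * h2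
    + (sphEigenvalue l - 1 - (k : ℝ) ^ 2) / 2 * h3

theorem normFactor_mul_intGDDG (hl : 1 ≤ l) (h : k ≤ l) :
    normFactor l k * intGDDG l k =
      -((2 * sphEigenvalue l + 1) / (2 * l + 1)) + k + if k = 0 then 1 else 0 := by
  have h1 := normFactor_mul_normSqDG hl h
  have h2 := normFactor_mul_normSqG hl h
  have h3 : normFactor l k * (if k = 0 then 1 else 0) = if k = 0 then 1 else 0 := by
    split_ifs with hk
    · rw [hk, normFactor_zero, one_mul]
    · rw [mul_zero]
  rw [intGDDG_eq, normSqDG]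
  linear_combination (-1) * h1 - h2 / 2 + h3

theorem normFactor_mul_normSqDDG (hl : 1 ≤ l) (h : k ≤ l) :
    normFactor l k * (∫ θ in (0 : ℝ)..π, sin θ * polarDDG l k θ ^ 2) = modeU l k := by
  have h1 := normSqDDG_add l k
  have h2 := normFactor_mul_intDDGZ hl h
  have h3 := normFactor_mul_intGDDG hl h
  rw [intDDGZ] at h1
  rw [modeU]
  linear_combination normFactor l k * h1 - h2 - sphEigenvalue l * h3

theorem normFactor_mul_normSqZ (hl : 1 ≤ l) (h : k ≤ l) :
    normFactor l k * (∫ θ in (0 : ℝ)..π, sin θ * polarZ l k θ ^ 2) = modeZ l k := by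
  have h1 := normSqZ_add l k
  have h2 := normFactor_mul_intDDGZ hl h
  have h3 := normFactor_mul_intGDDG hl h
  have h4 := normFactor_mul_normSqG hl h
  rw [intDDGZ] at h1
  rw [modeD] at h2
  rw [modeZ]
  linear_combination normFactor l k * h1 - h2 + sphEigenvalue l * h3 + sphEigenvalue l ^ 2 * h4

end PolarSecondOrder

/-! ### Fourier expansion in the longitude -/

section Fourier

open Real

/-- The real trigonometric sum `∑ₘ Re (bₘ e^{imφ}) h_{|m|}(θ)`. -/
noncomputable def harmSum (l : ℕ) (b : ℤ → ℂ) (h : ℕ → ℝ → ℝ) (θ φ : ℝ) : ℝ :=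
  ∑ m ∈ Finset.Icc (-(l : ℤ)) (l : ℤ),
    (b m * Complex.exp (Complex.I * m * φ)).re * h m.natAbs θ

theorem continuous_harmSum (l : ℕ) (b : ℤ → ℂ) {h : ℕ → ℝ → ℝ} (hh : ∀ k, Continuous (h k)) :
    Continuous fun p : ℝ × ℝ => harmSum l b h p.1 p.2 := by
  unfold harmSum
  refine continuous_finsetSum _ fun m _ => Continuous.mul ?_ ((hh _).comp continuous_fst)
  exact Complex.continuous_re.comp (by fun_prop)

theorem isCompact_chart_closure : IsCompact (Set.Icc 0 π ×ˢ Set.Icc 0 (2 * π) : Set (ℝ × ℝ)) :=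
  isCompact_Icc.prod isCompact_Icc

theorem Continuous.integrableOn_sphChart {E : Type*} [NormedAddCommGroup E] {F : ℝ × ℝ → E}
    (hF : Continuous F) : IntegrableOn F sphChart :=
  (hF.continuousOn.integrableOn_compact isCompact_chart_closure).mono_set
    (Set.prod_mono Set.Ioo_subset_Icc_self Set.Ioo_subset_Icc_self)

theorem measurableSet_sphChart : MeasurableSet sphChart :=
  measurableSet_Ioo.prod measurableSet_Ioo

/-- The singular coefficients `1 / sin θ` do no harm: on the bounded chart the integrands agree with
functions continuous on the whole plane. -/
theorem sphIntegrable_of_continuous {F : ℝ → ℝ → ℝ} {G : ℝ × ℝ → ℝ} (hG : Continuous G)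
    (h : ∀ p ∈ sphChart, F p.1 p.2 = G p) : SphIntegrable F := by
  have h1 : Continuous fun p : ℝ × ℝ => G p * sin p.1 := by fun_prop
  exact h1.integrableOn_sphChart.congr_fun (fun p hp => by simp only [h p hp])
    measurableSet_sphChart

theorem sphIntegral_congr {F G : ℝ → ℝ → ℝ}
    (h : ∀ p ∈ sphChart, F p.1 p.2 = G p.1 p.2) : sphIntegral F = sphIntegral G :=
  setIntegral_congr_fun measurableSet_sphChart fun p hp => by simp only [h p hp]

theorem integral_exp_int_mul (k : ℤ) :
    ∫ φ in Set.Ioo 0 (2 * π), Complex.exp (Complex.I * k * (φ : ℂ)) =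
      if k = 0 then ((2 * π : ℝ) : ℂ) else 0 := by
  rw [← integral_Ioc_eq_integral_Ioo, ← intervalIntegral.integral_of_le (by positivity)]
  split_ifs with h
  · subst h
    simp
  · have hk : Complex.I * (k : ℂ) ≠ 0 := mul_ne_zero Complex.I_ne_zero (by exact_mod_cast h)
    rw [integral_exp_mul_complex hk]
    have h1 : Complex.I * (k : ℂ) * ((2 * π : ℝ) : ℂ) = k * (2 * π * Complex.I) := by
      push_cast; ring
    rw [h1, Complex.exp_int_mul_two_pi_mul_I]
    simp

theorem integral_sphChart_mul (u v : ℝ → ℂ) :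
    ∫ p in sphChart, u p.1 * v p.2 =
      (∫ θ in Set.Ioo 0 π, u θ) * ∫ φ in Set.Ioo 0 (2 * π), v φ := by
  rw [sphChart, Measure.volume_eq_prod, setIntegral_prod_mul]

/-- The complex form of `harmSum`. -/
theorem ofReal_harmSum {l : ℕ} {b : ℤ → ℂ}
    (hb : ∀ m : ℤ, |m| ≤ (l : ℤ) → b (-m) = (starRingEnd ℂ) (b m)) (h : ℕ → ℝ → ℝ) (θ φ : ℝ) :
    (harmSum l b h θ φ : ℂ) = ∑ m ∈ Finset.Icc (-(l : ℤ)) (l : ℤ),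
      b m * Complex.exp (Complex.I * m * φ) * (h m.natAbs θ : ℂ) := by
  -- The substitution `m ↦ -m` shows that the complex sum is its own conjugate, so taking real parts
  -- changes nothing.
  have h1 : ∑ m ∈ Finset.Icc (-(l : ℤ)) (l : ℤ),
      b m * Complex.exp (Complex.I * m * φ) * (h m.natAbs θ : ℂ) =
      ∑ m ∈ Finset.Icc (-(l : ℤ)) (l : ℤ),
      (starRingEnd ℂ) (b m * Complex.exp (Complex.I * m * φ)) * (h m.natAbs θ : ℂ) := by
    refine Finset.sum_nbij' (fun m => -m) (fun m => -m) ?_ ?_ ?_ ?_ ?_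
    · intro m hm; simp only [Finset.mem_Icc] at hm ⊢; omega
    · intro m hm; simp only [Finset.mem_Icc] at hm ⊢; omega
    · intro m _; simp
    · intro m _; simp
    · intro m hm
      rw [Int.natAbs_neg, hb m (abs_le.2 (Finset.mem_Icc.1 hm))]
      simp [← Complex.exp_conj]
  rw [harmSum]
  push_cast
  have h2 : ∀ z : ℂ, (z.re : ℂ) = (z + (starRingEnd ℂ) z) / 2 := fun z => by
    rw [Complex.add_conj]; push_cast; ring
  simp only [h2, add_mul, add_div, div_mul_eq_mul_div, Finset.sum_add_distrib]
  rw [← Finset.sum_div, ← Finset.sum_div, ← h1]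
  ring

/-- Parseval's identity in the longitude. -/
theorem sphIntegral_harmSum_mul {l : ℕ} {b : ℤ → ℂ}
    (hb : ∀ m : ℤ, |m| ≤ (l : ℤ) → b (-m) = (starRingEnd ℂ) (b m)) {h h' : ℕ → ℝ → ℝ}
    (hh : ∀ k, Continuous (h k)) (hh' : ∀ k, Continuous (h' k)) :
    sphIntegral (fun θ φ => harmSum l b h θ φ * harmSum l b h' θ φ) =
      2 * π * ∑ m ∈ Finset.Icc (-(l : ℤ)) (l : ℤ),
        ‖b m‖ ^ 2 * ∫ θ in (0 : ℝ)..π, sin θ * (h m.natAbs θ * h' m.natAbs θ) := by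
  have key : ∀ p : ℝ × ℝ,
      ((harmSum l b h p.1 p.2 * harmSum l b h' p.1 p.2 * sin p.1 : ℝ) : ℂ) =
      ∑ m ∈ Finset.Icc (-(l : ℤ)) (l : ℤ), ∑ n ∈ Finset.Icc (-(l : ℤ)) (l : ℤ),
        (b m * (starRingEnd ℂ) (b n) * ((sin p.1 * (h m.natAbs p.1 * h' n.natAbs p.1) : ℝ) : ℂ)) *
          Complex.exp (Complex.I * (m - n : ℤ) * (p.2 : ℂ)) := by
    intro p
    -- The second factor is real and is replaced by its conjugate, so that the exponents become `m -
    -- n` and orthogonality keeps `n = m`.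
    have h1 : (harmSum l b h' p.1 p.2 : ℂ) = (starRingEnd ℂ) (harmSum l b h' p.1 p.2 : ℂ) :=
      (Complex.conj_ofReal _).symm
    push_cast
    rw [h1, ofReal_harmSum hb, ofReal_harmSum hb, map_sum, Finset.sum_mul_sum, Finset.sum_mul]
    refine Finset.sum_congr rfl fun m _ => ?_
    rw [Finset.sum_mul]
    refine Finset.sum_congr rfl fun n _ => ?_
    have h2 : Complex.exp (Complex.I * (m - n) * p.2) =
        Complex.exp (Complex.I * m * p.2) * (starRingEnd ℂ) (Complex.exp (Complex.I * n * p.2)) := by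
      rw [← Complex.exp_conj, ← Complex.exp_add]
      congr 1
      simp
      ring
    rw [h2]
    simp only [map_mul, Complex.conj_ofReal]
    ring
  have hint : ∀ m n : ℤ, IntegrableOn (fun p : ℝ × ℝ =>
      (b m * (starRingEnd ℂ) (b n) * ((sin p.1 * (h m.natAbs p.1 * h' n.natAbs p.1) : ℝ) : ℂ)) *
          Complex.exp (Complex.I * (m - n : ℤ) * (p.2 : ℂ))) sphChart := by
    intro m n
    have h1 := hh m.natAbs
    have h2 := hh' n.natAbs
    apply Continuous.integrableOn_sphChart
    fun_prop
  apply Complex.ofReal_injective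
  rw [sphIntegral, ← integral_complex_ofReal]
  simp only [key]
  rw [integral_finsetSum _ fun m _ => integrable_finsetSum _ fun n _ => hint m n]
  rw [Complex.ofReal_mul, Complex.ofReal_sum, Finset.mul_sum]
  refine Finset.sum_congr rfl fun m hm => ?_
  rw [integral_finsetSum _ fun n _ => hint m n, Finset.sum_eq_single m]
  · rw [integral_sphChart_mul
      (fun θ => b m * (starRingEnd ℂ) (b m) * ((sin θ * (h m.natAbs θ * h' m.natAbs θ) : ℝ) : ℂ))
      (fun φ => Complex.exp (Complex.I * (m - m : ℤ) * (φ : ℂ))), integral_exp_int_mul,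
      if_pos (sub_self m), integral_const_mul, integral_complex_ofReal,
      intervalIntegral.integral_of_le pi_pos.le, integral_Ioc_eq_integral_Ioo, Complex.mul_conj,
      Complex.normSq_eq_norm_sq]
    push_cast
    ring
  · intro n _ hn
    rw [integral_sphChart_mul
      (fun θ => b m * (starRingEnd ℂ) (b n) * ((sin θ * (h m.natAbs θ * h' n.natAbs θ) : ℝ) : ℂ))
      (fun φ => Complex.exp (Complex.I * (m - n : ℤ) * (φ : ℂ))), integral_exp_int_mul,
      if_neg (sub_ne_zero.2 hn.symm), mul_zero]
  · intro h1; exact absurd hm h1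

theorem sphIntegral_one : sphIntegral (fun _ _ => 1) = 4 * π := by
  have h := integral_sphChart_mul (fun θ => ((sin θ : ℝ) : ℂ)) (fun _ => 1)
  apply Complex.ofReal_injective
  rw [sphIntegral, ← integral_complex_ofReal]
  simp only [mul_one, one_mul] at h ⊢
  rw [h, integral_complex_ofReal, ← integral_Ioc_eq_integral_Ioo,
    ← intervalIntegral.integral_of_le pi_pos.le, integral_sin]
  simp [pi_pos.le]
  ring

end Fourier

/-! ### The field and its covariant derivatives in polar coordinates -/

section Field

open Real Filter Topology

theorem natAbs_cast_sq (m : ℤ) : (m.natAbs : ℝ) ^ 2 = (m : ℝ) ^ 2 := by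
  rw [Nat.cast_natAbs, Int.cast_abs, sq_abs]

/-- The coefficient of the mode `m` of the spherical eigenfunction. -/
noncomputable def modeCoeff (l : ℕ) (c : ℤ → ℂ) (m : ℤ) : ℂ :=
  c m * (if 0 ≤ m then 1 else (-1) ^ m.natAbs) *
    (((-1) ^ m.natAbs * √(normFactor l m.natAbs) : ℝ) : ℂ)

/-- The coefficient of the mode `m` of the derivative in the longitude. -/
noncomputable def lonCoeff (l : ℕ) (c : ℤ → ℂ) (m : ℤ) : ℂ :=
  Complex.I * m * modeCoeff l c m

theorem norm_modeCoeff_sq (l : ℕ) (c : ℤ → ℂ) (m : ℤ) :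
    ‖modeCoeff l c m‖ ^ 2 = ‖c m‖ ^ 2 * normFactor l m.natAbs := by
  have h1 : ‖(if 0 ≤ m then 1 else (-1) ^ m.natAbs : ℂ)‖ = 1 := by split_ifs <;> simp
  rw [modeCoeff, norm_mul, norm_mul, h1, mul_one, Complex.norm_real, norm_mul, norm_pow, norm_neg,
    norm_one, one_pow, one_mul, mul_pow, Real.norm_eq_abs, sq_abs,
    Real.sq_sqrt (normFactor_nonneg _ _)]

theorem norm_lonCoeff_sq (l : ℕ) (c : ℤ → ℂ) (m : ℤ) :
    ‖lonCoeff l c m‖ ^ 2 = ‖c m‖ ^ 2 * (normFactor l m.natAbs * (m.natAbs : ℝ) ^ 2) := by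
  rw [lonCoeff, norm_mul, norm_mul, Complex.norm_I, one_mul, mul_pow, norm_modeCoeff_sq,
    Complex.norm_intCast, sq_abs, natAbs_cast_sq]
  ring

/-- The sign `(-1)^{|m|}` in `Y_{ℓm}` for `m < 0` cancels the one in the symmetry of the
coefficients, leaving plain conjugate symmetry. -/
theorem modeCoeff_neg {l : ℕ} {c : ℤ → ℂ}
    (hc : ∀ m : ℤ, |m| ≤ (l : ℤ) → (-1 : ℂ) ^ m * c (-m) = (starRingEnd ℂ) (c m))
    (m : ℤ) (hm : |m| ≤ (l : ℤ)) :
    modeCoeff l c (-m) = (starRingEnd ℂ) (modeCoeff l c m) := by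
  have h1 := hc m hm
  simp only [modeCoeff, map_mul, Complex.conj_ofReal, Int.natAbs_neg, ← h1]
  congr 1
  have h2 : (starRingEnd ℂ) (if 0 ≤ m then 1 else (-1) ^ m.natAbs : ℂ) =
      if 0 ≤ m then 1 else (-1) ^ m.natAbs := by split_ifs <;> simp
  rw [h2]
  obtain ⟨k, rfl | rfl⟩ := m.eq_nat_or_neg
  · rcases Nat.eq_zero_or_pos k with rfl | hk
    · simp
    · rw [if_neg (by omega), if_pos (by omega)]
      simp [mul_comm]
  · rcases Nat.eq_zero_or_pos k with rfl | hk
    · simp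
    · rw [if_pos (by omega), if_neg (by omega)]
      have h3 : ((-1 : ℂ) ^ k) * (-1) ^ k = 1 := by rw [← mul_pow]; simp
      have h4 : (-1 : ℂ) ^ (-(k : ℤ)) = (-1) ^ k := by
        rw [zpow_neg, zpow_natCast]
        exact inv_eq_of_mul_eq_one_left h3
      rw [h4]
      simp only [Int.natAbs_neg, Int.natAbs_natCast, neg_neg]
      linear_combination (-c k) * h3

theorem lonCoeff_neg {l : ℕ} {c : ℤ → ℂ}
    (hc : ∀ m : ℤ, |m| ≤ (l : ℤ) → (-1 : ℂ) ^ m * c (-m) = (starRingEnd ℂ) (c m))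
    (m : ℤ) (hm : |m| ≤ (l : ℤ)) :
    lonCoeff l c (-m) = (starRingEnd ℂ) (lonCoeff l c m) := by
  rw [lonCoeff, lonCoeff, modeCoeff_neg hc m hm]
  simp

/-- The prefactor of `f_ℓ` cancels `(2ℓ+1)/(4π)`. The sign condition is needed for `√(1 - cos² θ) =
sin θ`, so `θ`-derivatives below are taken through equality near a point of `(0, π)`. -/
theorem sphField_eq_harmSum (l : ℕ) (c : ℤ → ℂ) {θ : ℝ} (hθ : 0 ≤ sin θ) (φ : ℝ) :
    sphField l c θ φ = harmSum l (modeCoeff l c) (polarG l) θ φ := by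
  have h1 : √(1 - cos θ ^ 2) = sin θ := by
    rw [← Real.sin_sq, Real.sqrt_sq hθ]
  rw [sphField, Finset.mul_sum, Complex.re_sum, harmSum]
  refine Finset.sum_congr rfl fun m _ => ?_
  have h2 : √(4 * π / (2 * l + 1)) * √((2 * l + 1) / (4 * π) *
      (((l - m.natAbs).factorial : ℝ) / (l + m.natAbs).factorial)) =
      √(normFactor l m.natAbs) := by
    rw [← Real.sqrt_mul (by positivity)]
    congr 1
    rw [normFactor]
    have := pi_pos
    field_simp
  rw [sphHarm, assocLegendre, h1, modeCoeff, polarG, legendreDeriv, ← h2, ← Complex.re_mul_ofReal]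
  congr 1
  push_cast
  ring

theorem hasDerivAt_harmSum_fst {l : ℕ} (b : ℤ → ℂ) {h h' : ℕ → ℝ → ℝ} {θ : ℝ}
    (hh : ∀ k, HasDerivAt (h k) (h' k θ) θ) (φ : ℝ) :
    HasDerivAt (fun t => harmSum l b h t φ) (harmSum l b h' θ φ) θ := by
  unfold harmSum
  exact HasDerivAt.fun_sum fun m _ => (hh m.natAbs).const_mul _

theorem hasDerivAt_harmSum_snd (l : ℕ) (b : ℤ → ℂ) (h : ℕ → ℝ → ℝ) (θ φ : ℝ) :
    HasDerivAt (fun s => harmSum l b h θ s)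
      (harmSum l (fun m => Complex.I * m * b m) h θ φ) φ := by
  unfold harmSum
  refine HasDerivAt.fun_sum fun m _ => HasDerivAt.mul_const ?_ _
  have h1 : HasDerivAt (fun z : ℂ => b m * Complex.exp (Complex.I * m * z))
      (Complex.I * m * b m * Complex.exp (Complex.I * m * φ)) (φ : ℂ) := by
    refine ((((hasDerivAt_id (φ : ℂ)).const_mul (Complex.I * (m : ℂ))).cexp).const_mul
      (b m)).congr_deriv ?_
    simp only [id]
    ring
  exact h1.real_of_complex

variable (l : ℕ) (c : ℤ → ℂ) {θ : ℝ} (φ : ℝ)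

theorem sphField_eventuallyEq (hθ : θ ∈ Set.Ioo 0 π) :
    (fun t => sphField l c t φ) =ᶠ[𝓝 θ]
      fun t => harmSum l (modeCoeff l c) (polarG l) t φ := by
  filter_upwards [isOpen_Ioo.mem_nhds hθ] with t ht
  exact sphField_eq_harmSum l c (sin_pos_of_mem_Ioo ht).le φ

theorem deriv_fst_sphField (hθ : θ ∈ Set.Ioo 0 π) :
    deriv (fun t => sphField l c t φ) θ =
      harmSum l (modeCoeff l c) (polarDG l) θ φ := by
  rw [(sphField_eventuallyEq l c φ hθ).deriv_eq]
  exact (hasDerivAt_harmSum_fst _ (fun k => hasDerivAt_polarG l k θ) φ).deriv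

theorem deriv_snd_sphField (hθ : θ ∈ Set.Ioo 0 π) :
    deriv (fun s => sphField l c θ s) φ =
      harmSum l (lonCoeff l c) (polarG l) θ φ := by
  simp only [sphField_eq_harmSum l c (sin_pos_of_mem_Ioo hθ).le]
  exact (hasDerivAt_harmSum_snd l (modeCoeff l c) (polarG l) θ φ).deriv

theorem deriv_fst_fst_sphField (hθ : θ ∈ Set.Ioo 0 π) :
    deriv (fun t => deriv (fun t' => sphField l c t' φ) t) θ =
      harmSum l (modeCoeff l c) (polarDDG l) θ φ := by
  have h : (fun t => deriv (fun t' => sphField l c t' φ) t) =ᶠ[𝓝 θ]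
      fun t => harmSum l (modeCoeff l c) (polarDG l) t φ := by
    filter_upwards [isOpen_Ioo.mem_nhds hθ] with t ht
    exact deriv_fst_sphField l c φ ht
  rw [h.deriv_eq]
  exact (hasDerivAt_harmSum_fst _ (fun k => hasDerivAt_polarDG l k θ) φ).deriv

theorem deriv_fst_snd_sphField (hθ : θ ∈ Set.Ioo 0 π) :
    deriv (fun t => deriv (fun s => sphField l c t s) φ) θ =
      harmSum l (lonCoeff l c) (polarDG l) θ φ := by
  have h : (fun t => deriv (fun s => sphField l c t s) φ) =ᶠ[𝓝 θ]
      fun t => harmSum l (lonCoeff l c) (polarG l) t φ := by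
    filter_upwards [isOpen_Ioo.mem_nhds hθ] with t ht
    exact deriv_snd_sphField l c φ ht
  rw [h.deriv_eq]
  exact (hasDerivAt_harmSum_fst _ (fun k => hasDerivAt_polarG l k θ) φ).deriv

theorem deriv_snd_snd_sphField (hθ : θ ∈ Set.Ioo 0 π) :
    deriv (fun s => deriv (fun s' => sphField l c θ s') s) φ =
      harmSum l (fun m => Complex.I * m * lonCoeff l c m) (polarG l) θ φ := by
  simp only [deriv_snd_sphField l c _ hθ]
  exact (hasDerivAt_harmSum_snd l (lonCoeff l c) (polarG l) θ φ).deriv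

theorem gradOne_sphField (hθ : θ ∈ Set.Ioo 0 π) :
    gradOne (sphField l c) θ φ = harmSum l (modeCoeff l c) (polarDG l) θ φ :=
  deriv_fst_sphField l c φ hθ

theorem hessOneOne_sphField (hθ : θ ∈ Set.Ioo 0 π) :
    hessOneOne (sphField l c) θ φ = harmSum l (modeCoeff l c) (polarDDG l) θ φ :=
  deriv_fst_fst_sphField l c φ hθ

theorem gradTwo_sphField (hθ : θ ∈ Set.Ioo 0 π) :
    gradTwo (sphField l c) θ φ = harmSum l (lonCoeff l c) (polarQ l) θ φ := by
  have hs := (sin_pos_of_mem_Ioo hθ).ne'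
  rw [gradTwo, deriv_snd_sphField l c φ hθ, harmSum, harmSum, Finset.mul_sum]
  refine Finset.sum_congr rfl fun m _ => ?_
  rcases eq_or_ne m 0 with rfl | hm
  · simp [lonCoeff]
  · obtain ⟨k, hk⟩ := Nat.exists_eq_succ_of_ne_zero (Int.natAbs_ne_zero.2 hm)
    rw [hk, ← sin_mul_polarQ_succ]
    field_simp

theorem hessOneTwo_sphField (hθ : θ ∈ Set.Ioo 0 π) :
    hessOneTwo (sphField l c) θ φ = harmSum l (lonCoeff l c) (polarDQ l) θ φ := by
  have hs := (sin_pos_of_mem_Ioo hθ).ne'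
  rw [hessOneTwo, deriv_snd_sphField l c φ hθ, deriv_fst_snd_sphField l c φ hθ, harmSum, harmSum,
    harmSum, Finset.mul_sum, ← Finset.sum_sub_distrib, Finset.mul_sum]
  refine Finset.sum_congr rfl fun m _ => ?_
  rcases eq_or_ne m 0 with rfl | hm
  · simp [lonCoeff]
  · obtain ⟨k, hk⟩ := Nat.exists_eq_succ_of_ne_zero (Int.natAbs_ne_zero.2 hm)
    rw [hk, Nat.succ_eq_add_one, ← sin_mul_polarQ_succ, polarDG_succ_eq]
    field_simp
    ring

/-- Two derivatives in `φ` multiply the mode `m` by `-m²`; what remains is Legendre's equation,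
`sin_mul_polarZ`. -/
theorem hessTwoTwo_sphField (hθ : θ ∈ Set.Ioo 0 π) :
    hessTwoTwo (sphField l c) θ φ = harmSum l (modeCoeff l c) (polarZ l) θ φ := by
  have hs := (sin_pos_of_mem_Ioo hθ).ne'
  rw [hessTwoTwo, deriv_snd_snd_sphField l c φ hθ, deriv_fst_sphField l c φ hθ, harmSum, harmSum,
    harmSum, Finset.mul_sum, ← Finset.sum_add_distrib, Finset.mul_sum]
  refine Finset.sum_congr rfl fun m _ => ?_
  have h1 := sin_mul_polarZ l m.natAbs θ
  have h2 := mul_sin_mul_polarQ l m.natAbs θ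
  have h3 : (Complex.I * m * lonCoeff l c m * Complex.exp (Complex.I * m * φ)).re =
      -((m.natAbs : ℝ) ^ 2) * (modeCoeff l c m * Complex.exp (Complex.I * m * φ)).re := by
    rw [← Complex.re_ofReal_mul]
    congr 1
    have h4 : ((m.natAbs : ℝ) : ℂ) ^ 2 = (m : ℂ) ^ 2 := by
      exact_mod_cast congrArg Complex.ofReal (natAbs_cast_sq m)
    rw [lonCoeff, Complex.ofReal_neg, Complex.ofReal_pow, h4]
    linear_combination (m : ℂ) ^ 2 * modeCoeff l c m * Complex.exp (Complex.I * m * φ)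
      * Complex.I_sq
  rw [h3, div_mul_eq_mul_div, one_mul, div_eq_iff (pow_ne_zero 2 hs)]
  linear_combination (-(sin θ * (modeCoeff l c m * Complex.exp (Complex.I * m * φ)).re)) * h1
    + (m.natAbs * (modeCoeff l c m * Complex.exp (Complex.I * m * φ)).re) * h2

end Field

/-! ### The normalized vector -/

section NormVec

open Real

/-- The only off-diagonal entry is `e`, so only the last coordinate mixes two components; hence `Y₅`
involves `e₂e₂f - (λ₂/λ₃) e₁e₁f`. -/
theorem inv_mulVec_lower {a b c d e f : ℝ} (ha : a ≠ 0) (hb : b ≠ 0) (hc : c ≠ 0) (hd : d ≠ 0)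
    (hf : f ≠ 0) (v : Fin 5 → ℝ) :
    Matrix.mulVec (!![a, 0, 0, 0, 0; 0, b, 0, 0, 0; 0, 0, c, 0, 0; 0, 0, 0, d, 0;
      0, 0, e, 0, f] : Matrix (Fin 5) (Fin 5) ℝ)⁻¹ v =
      ![v 0 / a, v 1 / b, v 2 / c, v 3 / d, (v 4 - e / c * v 2) / f] := by
  have h : (!![a⁻¹, 0, 0, 0, 0; 0, b⁻¹, 0, 0, 0; 0, 0, c⁻¹, 0, 0; 0, 0, 0, d⁻¹, 0;
      0, 0, -(e / c / f), 0, f⁻¹] : Matrix (Fin 5) (Fin 5) ℝ) *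
      !![a, 0, 0, 0, 0; 0, b, 0, 0, 0; 0, 0, c, 0, 0; 0, 0, 0, d, 0; 0, 0, e, 0, f] = 1 := by
    ext i j
    fin_cases i <;> fin_cases j <;>
      simp [Matrix.mul_apply, Fin.sum_univ_five, ha, hb, hc, hd, hf]
    field_simp
    ring
  rw [Matrix.inv_eq_left_inv h]
  ext i
  fin_cases i <;> simp [Matrix.mulVec, dotProduct, Fin.sum_univ_five] <;> field_simp
  ring

variable {l : ℕ}

theorem six_le_sphEigenvalue (hl : 2 ≤ l) : 6 ≤ sphEigenvalue l := by
  have : (2 : ℝ) ≤ l := by exact_mod_cast hl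
  rw [sphEigenvalue]; nlinarith

/-- The quotient `λ₂ / λ₃` of the entries of the Cholesky factor. -/
noncomputable def cholRatio (l : ℕ) : ℝ := (sphEigenvalue l + 2) / (3 * sphEigenvalue l - 2)

/-- The entry `λ₃` of the Cholesky factor. -/
noncomputable def cholThree (l : ℕ) : ℝ :=
  √(sphEigenvalue l) * √(3 * sphEigenvalue l - 2) / (2 * √2)

/-- The entry `λ₄` of the Cholesky factor. -/
noncomputable def cholFour (l : ℕ) : ℝ :=
  √(sphEigenvalue l) * √(sphEigenvalue l - 2) / (2 * √2)

/-- The entry `λ₅` of the Cholesky factor. -/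
noncomputable def cholFive (l : ℕ) : ℝ :=
  sphEigenvalue l * √(sphEigenvalue l - 2) / √(3 * sphEigenvalue l - 2)

theorem normVec_eq (hl : 2 ≤ l) (c : ℤ → ℂ) (θ φ : ℝ) :
    normVec l c θ φ =
      ![gradOne (sphField l c) θ φ / (√(sphEigenvalue l) / √2),
        gradTwo (sphField l c) θ φ / (√(sphEigenvalue l) / √2),
        hessOneOne (sphField l c) θ φ / cholThree l,
        hessOneTwo (sphField l c) θ φ / cholFour l,
        (hessTwoTwo (sphField l c) θ φ - cholRatio l * hessOneOne (sphField l c) θ φ)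
          / cholFive l] := by
  have hL := six_le_sphEigenvalue hl
  have h1 : √(sphEigenvalue l) ≠ 0 := (Real.sqrt_pos.2 (by linarith)).ne'
  have h2 : √(sphEigenvalue l - 2) ≠ 0 := (Real.sqrt_pos.2 (by linarith)).ne'
  have h3 : √(3 * sphEigenvalue l - 2) ≠ 0 := (Real.sqrt_pos.2 (by linarith)).ne'
  have h4 : √(2 : ℝ) ≠ 0 := (Real.sqrt_pos.2 (by norm_num)).ne'
  have h5 : sphEigenvalue l ≠ 0 := by linarith
  have h6 : √(3 * sphEigenvalue l - 2) ^ 2 = 3 * sphEigenvalue l - 2 :=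
    Real.sq_sqrt (by linarith)
  rw [normVec, cholFactor, inv_mulVec_lower (by positivity) (by positivity) (by positivity)
    (by positivity) (by positivity)]
  have h7 : √(sphEigenvalue l) * (sphEigenvalue l + 2) / (2 * √2 * √(3 * sphEigenvalue l - 2)) /
      (√(sphEigenvalue l) * √(3 * sphEigenvalue l - 2) / (2 * √2)) = cholRatio l := by
    rw [cholRatio]
    conv_rhs => rw [← h6]
    generalize √(3 * sphEigenvalue l - 2) = s at h3 ⊢
    field_simp
  rw [h7]
  rfl

theorem sqrt_div_sqrt_two_sq (l : ℕ) : (√(sphEigenvalue l) / √2) ^ 2 = sphEigenvalue l / 2 := by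
  have h0 : 0 ≤ sphEigenvalue l := by rw [sphEigenvalue]; positivity
  rw [div_pow, Real.sq_sqrt h0, Real.sq_sqrt (by norm_num)]

theorem cholThree_sq (hl : 2 ≤ l) :
    cholThree l ^ 2 = sphEigenvalue l * (3 * sphEigenvalue l - 2) / 8 := by
  have hL := six_le_sphEigenvalue hl
  rw [cholThree, div_pow, mul_pow, mul_pow, Real.sq_sqrt (by linarith),
    Real.sq_sqrt (by linarith), Real.sq_sqrt (by norm_num)]
  norm_num

theorem cholFour_sq (hl : 2 ≤ l) :
    cholFour l ^ 2 = sphEigenvalue l * (sphEigenvalue l - 2) / 8 := by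
  have hL := six_le_sphEigenvalue hl
  rw [cholFour, div_pow, mul_pow, mul_pow, Real.sq_sqrt (by linarith),
    Real.sq_sqrt (by linarith), Real.sq_sqrt (by norm_num)]
  norm_num

theorem cholFive_sq (hl : 2 ≤ l) :
    cholFive l ^ 2 =
      sphEigenvalue l ^ 2 * (sphEigenvalue l - 2) / (3 * sphEigenvalue l - 2) := by
  have hL := six_le_sphEigenvalue hl
  rw [cholFive, div_pow, mul_pow, Real.sq_sqrt (by linarith), Real.sq_sqrt (by linarith)]

theorem cholThree_mul_cholFive (hl : 2 ≤ l) :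
    cholThree l * cholFive l =
      sphEigenvalue l * √(sphEigenvalue l) * √(sphEigenvalue l - 2) / (2 * √2) := by
  have hL := six_le_sphEigenvalue hl
  have h3 : √(3 * sphEigenvalue l - 2) ≠ 0 := (Real.sqrt_pos.2 (by linarith)).ne'
  rw [cholThree, cholFive]
  field_simp

theorem harmSum_div (l : ℕ) (b : ℤ → ℂ) (h : ℕ → ℝ → ℝ) (a θ φ : ℝ) :
    harmSum l b h θ φ / a = harmSum l b (fun k t => h k t / a) θ φ := by
  simp only [harmSum, Finset.sum_div, mul_div_assoc]

theorem harmSum_sub_mul (l : ℕ) (b : ℤ → ℂ) (h h' : ℕ → ℝ → ℝ) (a θ φ : ℝ) :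
    harmSum l b h θ φ - a * harmSum l b h' θ φ =
      harmSum l b (fun k t => h k t - a * h' k t) θ φ := by
  simp only [harmSum, Finset.mul_sum, ← Finset.sum_sub_distrib]
  exact Finset.sum_congr rfl fun m _ => by ring

variable {c : ℤ → ℂ}

theorem normVec_zero (hl : 2 ≤ l) (p : ℝ × ℝ) (hp : p ∈ sphChart) :
    normVec l c p.1 p.2 0 = harmSum l (modeCoeff l c)
      (fun k t => polarDG l k t / (√(sphEigenvalue l) / √2)) p.1 p.2 := by
  simp [normVec_eq hl, gradOne_sphField l c p.2 hp.1, harmSum_div]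

theorem normVec_one (hl : 2 ≤ l) (p : ℝ × ℝ) (hp : p ∈ sphChart) :
    normVec l c p.1 p.2 1 = harmSum l (lonCoeff l c)
      (fun k t => polarQ l k t / (√(sphEigenvalue l) / √2)) p.1 p.2 := by
  simp [normVec_eq hl, gradTwo_sphField l c p.2 hp.1, harmSum_div]

theorem normVec_two (hl : 2 ≤ l) (p : ℝ × ℝ) (hp : p ∈ sphChart) :
    normVec l c p.1 p.2 2 = harmSum l (modeCoeff l c)
      (fun k t => polarDDG l k t / cholThree l) p.1 p.2 := by
  simp [normVec_eq hl, hessOneOne_sphField l c p.2 hp.1, harmSum_div]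

theorem normVec_three (hl : 2 ≤ l) (p : ℝ × ℝ) (hp : p ∈ sphChart) :
    normVec l c p.1 p.2 3 = harmSum l (lonCoeff l c)
      (fun k t => polarDQ l k t / cholFour l) p.1 p.2 := by
  simp [normVec_eq hl, hessOneTwo_sphField l c p.2 hp.1, harmSum_div]

theorem normVec_four (hl : 2 ≤ l) (p : ℝ × ℝ) (hp : p ∈ sphChart) :
    normVec l c p.1 p.2 4 = harmSum l (modeCoeff l c)
      (fun k t => (polarZ l k t - cholRatio l * polarDDG l k t) / cholFive l) p.1 p.2 := by
  simp [normVec_eq hl, hessOneOne_sphField l c p.2 hp.1, hessTwoTwo_sphField l c p.2 hp.1,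
    harmSum_div, harmSum_sub_mul]

theorem hermiteTwo_eq (x : ℝ) : hermiteTwo x = x * x - 1 := by
  rw [hermiteTwo, Polynomial.hermite_succ, Polynomial.hermite_one]
  simp

section

variable {i j : Fin 5} {b : ℤ → ℂ} {h h' : ℕ → ℝ → ℝ}

theorem sphIntegrable_hermiteTwo
    (hn : ∀ p ∈ sphChart, normVec l c p.1 p.2 i = harmSum l b h p.1 p.2)
    (hh : ∀ k, Continuous (h k)) :
    SphIntegrable fun θ φ => hermiteTwo (normVec l c θ φ i) := by
  have h1 := continuous_harmSum l b hh
  refine sphIntegrable_of_continuous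
    (G := fun p => harmSum l b h p.1 p.2 * harmSum l b h p.1 p.2 - 1) (by fun_prop) fun p hp => ?_
  rw [hermiteTwo_eq, hn p hp]

theorem sphIntegrable_mul
    (hn : ∀ p ∈ sphChart, normVec l c p.1 p.2 i = harmSum l b h p.1 p.2)
    (hn' : ∀ p ∈ sphChart, normVec l c p.1 p.2 j = harmSum l b h' p.1 p.2)
    (hh : ∀ k, Continuous (h k)) (hh' : ∀ k, Continuous (h' k)) :
    SphIntegrable fun θ φ => normVec l c θ φ i * normVec l c θ φ j := by
  have h1 := continuous_harmSum l b hh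
  have h2 := continuous_harmSum l b hh'
  refine sphIntegrable_of_continuous
    (G := fun p => harmSum l b h p.1 p.2 * harmSum l b h' p.1 p.2) (by fun_prop) fun p hp => ?_
  rw [hn p hp, hn' p hp]

theorem crossInt_eq
    (hn : ∀ p ∈ sphChart, normVec l c p.1 p.2 i = harmSum l b h p.1 p.2)
    (hn' : ∀ p ∈ sphChart, normVec l c p.1 p.2 j = harmSum l b h' p.1 p.2)
    (hb : ∀ m : ℤ, |m| ≤ (l : ℤ) → b (-m) = (starRingEnd ℂ) (b m))
    (hh : ∀ k, Continuous (h k)) (hh' : ∀ k, Continuous (h' k)) :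
    crossInt l c i j = 2 * π * ∑ m ∈ Finset.Icc (-(l : ℤ)) (l : ℤ),
        ‖b m‖ ^ 2 * ∫ θ in (0 : ℝ)..π, sin θ * (h m.natAbs θ * h' m.natAbs θ) := by
  rw [← sphIntegral_harmSum_mul hb hh hh', crossInt]
  exact sphIntegral_congr fun p hp => by rw [hn p hp, hn' p hp]

theorem hermiteInt_eq
    (hn : ∀ p ∈ sphChart, normVec l c p.1 p.2 i = harmSum l b h p.1 p.2)
    (hb : ∀ m : ℤ, |m| ≤ (l : ℤ) → b (-m) = (starRingEnd ℂ) (b m))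
    (hh : ∀ k, Continuous (h k)) :
    hermiteInt l c i = 2 * π * ∑ m ∈ Finset.Icc (-(l : ℤ)) (l : ℤ),
        ‖b m‖ ^ 2 * (∫ θ in (0 : ℝ)..π, sin θ * h m.natAbs θ ^ 2) - 4 * π := by
  have h1 := continuous_harmSum l b hh
  have h2 : ∀ m : ℤ, (∫ θ in (0 : ℝ)..π, sin θ * h m.natAbs θ ^ 2) =
      ∫ θ in (0 : ℝ)..π, sin θ * (h m.natAbs θ * h m.natAbs θ) := fun m => by
    simp only [sq]
  simp only [h2]
  rw [← sphIntegral_harmSum_mul hb hh hh, ← sphIntegral_one, hermiteInt, sphIntegral, sphIntegral,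
    sphIntegral, ← integral_sub]
  · refine setIntegral_congr_fun measurableSet_sphChart fun p hp => ?_
    simp only [hermiteTwo_eq, hn p hp]
    ring
  · exact Continuous.integrableOn_sphChart (F := fun p =>
      harmSum l b h p.1 p.2 * harmSum l b h p.1 p.2 * sin p.1) (by fun_prop)
  · exact Continuous.integrableOn_sphChart (F := fun p => 1 * sin p.1) (by fun_prop)

end

/-! ### Exact weights of the modes, and the integrals as diagonal quadratic forms. -/

/-- The weight of the mode `k` in `B₁`. -/
noncomputable def weightOne (l k : ℕ) : ℝ :=
  (2 * sphEigenvalue l / (2 * l + 1) - k) / sphEigenvalue l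

/-- The weight of the mode `k` in `B₂`. -/
noncomputable def weightTwo (l k : ℕ) : ℝ := k / sphEigenvalue l

/-- The weight of the mode `k` in `B₃`. -/
noncomputable def weightThree (l k : ℕ) : ℝ :=
  4 * modeU l k / (sphEigenvalue l * (3 * sphEigenvalue l - 2))

/-- The weight of the mode `k` in `B₄`. -/
noncomputable def weightFour (l k : ℕ) : ℝ :=
  4 * modeJ l k / (sphEigenvalue l * (sphEigenvalue l - 2))

/-- The weight of the mode `k` in `B₅`. -/
noncomputable def weightFive (l k : ℕ) : ℝ :=
  (modeZ l k - 2 * cholRatio l * modeD l k + cholRatio l ^ 2 * modeU l k) *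
    (3 * sphEigenvalue l - 2) / (2 * (sphEigenvalue l ^ 2 * (sphEigenvalue l - 2)))

/-- The weight of the mode `k` in `A₃₅`. -/
noncomputable def weightCross (l k : ℕ) : ℝ :=
  √2 * (modeD l k - cholRatio l * modeU l k) /
    (sphEigenvalue l * √(sphEigenvalue l) * √(sphEigenvalue l - 2))

theorem integral_sin_mul_div_sq (h : ℝ → ℝ) (a : ℝ) :
    (∫ θ in (0 : ℝ)..π, sin θ * (h θ / a) ^ 2) =
      (∫ θ in (0 : ℝ)..π, sin θ * h θ ^ 2) / a ^ 2 := by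
  rw [← intervalIntegral.integral_div]
  congr 1; ext θ; ring

theorem two_pi_mul_sum {f : ℤ → ℝ} {w : ℕ → ℝ}
    (h : ∀ m : ℤ, m.natAbs ≤ l → f m = ‖c m‖ ^ 2 * (2 * w m.natAbs)) :
    2 * π * ∑ m ∈ Finset.Icc (-(l : ℤ)) (l : ℤ), f m =
      4 * π * ∑ m ∈ Finset.Icc (-(l : ℤ)) (l : ℤ), ‖c m‖ ^ 2 * w m.natAbs := by
  rw [Finset.mul_sum, Finset.mul_sum]
  refine Finset.sum_congr rfl fun m hm => ?_
  rw [Finset.mem_Icc] at hm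
  rw [h m (by omega)]
  ring

theorem hermiteInt_zero_eq (hl : 2 ≤ l)
    (hc : ∀ m : ℤ, |m| ≤ (l : ℤ) → (-1 : ℂ) ^ m * c (-m) = (starRingEnd ℂ) (c m)) :
    hermiteInt l c 0 = 4 * π * ∑ m ∈ Finset.Icc (-(l : ℤ)) (l : ℤ),
      ‖c m‖ ^ 2 * weightOne l m.natAbs - 4 * π := by
  have hL := six_le_sphEigenvalue hl
  rw [hermiteInt_eq (normVec_zero hl) (modeCoeff_neg hc) (fun k => by fun_prop),
    two_pi_mul_sum fun m hm => ?_]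
  rw [norm_modeCoeff_sq, integral_sin_mul_div_sq, sqrt_div_sqrt_two_sq, mul_assoc, ← mul_div_assoc,
    normFactor_mul_normSqDG (by omega) hm, weightOne]
  field_simp

theorem hermiteInt_one_eq (hl : 2 ≤ l)
    (hc : ∀ m : ℤ, |m| ≤ (l : ℤ) → (-1 : ℂ) ^ m * c (-m) = (starRingEnd ℂ) (c m)) :
    hermiteInt l c 1 = 4 * π * ∑ m ∈ Finset.Icc (-(l : ℤ)) (l : ℤ),
      ‖c m‖ ^ 2 * weightTwo l m.natAbs - 4 * π := by
  have hL := six_le_sphEigenvalue hl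
  rw [hermiteInt_eq (normVec_one hl) (lonCoeff_neg hc) (fun k => by fun_prop),
    two_pi_mul_sum fun m hm => ?_]
  rw [norm_lonCoeff_sq, integral_sin_mul_div_sq, sqrt_div_sqrt_two_sq, mul_assoc, ← mul_div_assoc,
    mul_assoc (normFactor _ _), normFactor_mul_normSqQ hm, weightTwo]
  field_simp

theorem hermiteInt_two_eq (hl : 2 ≤ l)
    (hc : ∀ m : ℤ, |m| ≤ (l : ℤ) → (-1 : ℂ) ^ m * c (-m) = (starRingEnd ℂ) (c m)) :
    hermiteInt l c 2 = 4 * π * ∑ m ∈ Finset.Icc (-(l : ℤ)) (l : ℤ),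
      ‖c m‖ ^ 2 * weightThree l m.natAbs - 4 * π := by
  rw [hermiteInt_eq (normVec_two hl) (modeCoeff_neg hc) (fun k => by fun_prop),
    two_pi_mul_sum fun m hm => ?_]
  rw [norm_modeCoeff_sq, integral_sin_mul_div_sq, cholThree_sq hl, mul_assoc, ← mul_div_assoc,
    normFactor_mul_normSqDDG (by omega) hm, weightThree, div_div_eq_mul_div]
  ring

theorem hermiteInt_three_eq (hl : 2 ≤ l)
    (hc : ∀ m : ℤ, |m| ≤ (l : ℤ) → (-1 : ℂ) ^ m * c (-m) = (starRingEnd ℂ) (c m)) :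
    hermiteInt l c 3 = 4 * π * ∑ m ∈ Finset.Icc (-(l : ℤ)) (l : ℤ),
      ‖c m‖ ^ 2 * weightFour l m.natAbs - 4 * π := by
  rw [hermiteInt_eq (normVec_three hl) (lonCoeff_neg hc) (fun k => by fun_prop),
    two_pi_mul_sum fun m hm => ?_]
  rw [norm_lonCoeff_sq, integral_sin_mul_div_sq, cholFour_sq hl, mul_assoc, ← mul_div_assoc,
    mul_assoc (normFactor _ _), normFactor_mul_normSqDQ hm, weightFour, div_div_eq_mul_div]
  ring

theorem normFactor_mul_integral_five {k : ℕ} (hl : 2 ≤ l) (hk : k ≤ l) :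
    normFactor l k * (∫ θ in (0 : ℝ)..π,
      sin θ * (polarZ l k θ - cholRatio l * polarDDG l k θ) ^ 2) =
      modeZ l k - 2 * cholRatio l * modeD l k + cholRatio l ^ 2 * modeU l k := by
  have h : (∫ θ in (0 : ℝ)..π, sin θ * (polarZ l k θ - cholRatio l * polarDDG l k θ) ^ 2) =
      (∫ θ in (0 : ℝ)..π, sin θ * polarZ l k θ ^ 2)
      - 2 * cholRatio l * (∫ θ in (0 : ℝ)..π, sin θ * (polarDDG l k θ * polarZ l k θ))
      + cholRatio l ^ 2 * (∫ θ in (0 : ℝ)..π, sin θ * polarDDG l k θ ^ 2) := by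
    rw [← intervalIntegral.integral_const_mul, ← intervalIntegral.integral_const_mul,
      ← intervalIntegral.integral_sub (Continuous.intervalIntegrable (by fun_prop) _ _)
        (Continuous.intervalIntegrable (by fun_prop) _ _),
      ← intervalIntegral.integral_add (Continuous.intervalIntegrable (by fun_prop) _ _)
        (Continuous.intervalIntegrable (by fun_prop) _ _)]
    congr 1; ext θ; ring
  rw [h, ← normFactor_mul_normSqDDG (by omega) hk, ← normFactor_mul_normSqZ (by omega) hk,
    ← normFactor_mul_intDDGZ (by omega) hk]
  ring

theorem normFactor_mul_integral_cross {k : ℕ} (hl : 2 ≤ l) (hk : k ≤ l) :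
    normFactor l k * (∫ θ in (0 : ℝ)..π, sin θ * (polarDDG l k θ / cholThree l *
      ((polarZ l k θ - cholRatio l * polarDDG l k θ) / cholFive l))) =
      (modeD l k - cholRatio l * modeU l k) / (cholThree l * cholFive l) := by
  have h : (∫ θ in (0 : ℝ)..π, sin θ * (polarDDG l k θ / cholThree l *
      ((polarZ l k θ - cholRatio l * polarDDG l k θ) / cholFive l))) =
      ((∫ θ in (0 : ℝ)..π, sin θ * (polarDDG l k θ * polarZ l k θ))
      - cholRatio l * (∫ θ in (0 : ℝ)..π, sin θ * polarDDG l k θ ^ 2))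
        / (cholThree l * cholFive l) := by
    rw [← intervalIntegral.integral_const_mul,
      ← intervalIntegral.integral_sub (Continuous.intervalIntegrable (by fun_prop) _ _)
        (Continuous.intervalIntegrable (by fun_prop) _ _), ← intervalIntegral.integral_div]
    congr 1; ext θ; ring
  rw [h, ← normFactor_mul_normSqDDG (by omega) hk, ← normFactor_mul_intDDGZ (by omega) hk]
  ring

theorem hermiteInt_four_eq (hl : 2 ≤ l)
    (hc : ∀ m : ℤ, |m| ≤ (l : ℤ) → (-1 : ℂ) ^ m * c (-m) = (starRingEnd ℂ) (c m)) :
    hermiteInt l c 4 = 4 * π * ∑ m ∈ Finset.Icc (-(l : ℤ)) (l : ℤ),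
      ‖c m‖ ^ 2 * weightFive l m.natAbs - 4 * π := by
  rw [hermiteInt_eq (normVec_four hl) (modeCoeff_neg hc) (fun k => by fun_prop),
    two_pi_mul_sum fun m hm => ?_]
  rw [norm_modeCoeff_sq, integral_sin_mul_div_sq, cholFive_sq hl, mul_assoc, ← mul_div_assoc,
    normFactor_mul_integral_five hl hm, weightFive, div_div_eq_mul_div]
  generalize sphEigenvalue l ^ 2 * (sphEigenvalue l - 2) = W
  ring

theorem crossInt_two_four_eq (hl : 2 ≤ l)
    (hc : ∀ m : ℤ, |m| ≤ (l : ℤ) → (-1 : ℂ) ^ m * c (-m) = (starRingEnd ℂ) (c m)) :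
    crossInt l c 2 4 = 4 * π * ∑ m ∈ Finset.Icc (-(l : ℤ)) (l : ℤ),
      ‖c m‖ ^ 2 * weightCross l m.natAbs := by
  rw [crossInt_eq (normVec_two hl) (normVec_four hl) (modeCoeff_neg hc) (fun k => by fun_prop)
    (fun k => by fun_prop), two_pi_mul_sum fun m hm => ?_]
  rw [norm_modeCoeff_sq, mul_assoc, normFactor_mul_integral_cross hl hm,
    cholThree_mul_cholFive hl, weightCross, div_div_eq_mul_div]
  ring

end NormVec

/-! ### Asymptotics of the weights -/

section Weights

/-- The scales for `x = ℓ`: a numerator of order `x³` known up to `x²`, times a reciprocal of order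
`x⁻⁴` known up to `x⁻⁵`, is known up to `x⁻²`. -/
theorem abs_mul_sub_mul_le {x u u₀ a a₀ c₁ c₂ c₃ c₄ : ℝ} (hx : 0 < x)
    (h1 : |u - u₀| ≤ c₁ * x ^ 2) (h2 : |a| ≤ c₂ / x ^ 4) (h3 : |u₀| ≤ c₃ * x ^ 3)
    (h4 : |a - a₀| ≤ c₄ / x ^ 5) :
    |u * a - u₀ * a₀| ≤ (c₁ * c₂ + c₃ * c₄) / x ^ 2 := by
  have h5 : u * a - u₀ * a₀ = (u - u₀) * a + u₀ * (a - a₀) := by ring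
  calc |u * a - u₀ * a₀| ≤ |u - u₀| * |a| + |u₀| * |a - a₀| := by
        rw [h5, ← abs_mul, ← abs_mul]; exact abs_add_le _ _
    _ ≤ (c₁ * x ^ 2) * (c₂ / x ^ 4) + (c₃ * x ^ 3) * (c₄ / x ^ 5) := by
        gcongr
        · exact (abs_nonneg _).trans h1
        · exact (abs_nonneg _).trans h3
    _ = (c₁ * c₂ + c₃ * c₄) / x ^ 2 := by field_simp

theorem abs_div_sub_div_le {x n d c : ℝ} (hx : 0 < x) (hd : x ^ 4 ≤ d)
    (hd' : d ≤ x ^ 4 + c * x ^ 3) (hn : 0 ≤ n) : |n / d - n / x ^ 4| ≤ n * c / x ^ 5 := by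
  have hx4 : 0 < x ^ 4 := by positivity
  have hd0 : 0 < d := hx4.trans_le hd
  have h : n / d - n / x ^ 4 = -(n * ((d - x ^ 4) / (d * x ^ 4))) := by
    field_simp; ring
  rw [h, abs_neg, abs_of_nonneg (mul_nonneg hn (div_nonneg (by linarith) (by positivity))),
    mul_div_assoc]
  refine mul_le_mul_of_nonneg_left ?_ hn
  calc (d - x ^ 4) / (d * x ^ 4) ≤ (c * x ^ 3) / (x ^ 4 * x ^ 4) :=
        div_le_div₀ (by linarith) (by linarith) (by positivity) (by gcongr)
    _ = c / x ^ 5 := by field_simp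

variable {l k : ℕ}

theorem sphEigenvalue_sq_le (hl : 2 ≤ l) :
    sphEigenvalue l * sphEigenvalue l ≤ (l : ℝ) ^ 4 + 3 * (l : ℝ) ^ 3 := by
  have hx : (2 : ℝ) ≤ l := by exact_mod_cast hl
  have h : (l : ℝ) ^ 2 * 1 ≤ (l : ℝ) ^ 2 * l := by gcongr; linarith
  rw [sphEigenvalue]
  nlinarith only [h]

/-- Leading cubic parts in `k` and `l`. The fractions with denominator `2 l + 1`, the indicator of
`k = 0` and the products with them become bounded atoms, after which all eight inequalities are
linear. -/
theorem mode_bounds (hl : 2 ≤ l) (hk : k ≤ l) :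
    |modeJ l k - ((k : ℝ) * l ^ 2 - k ^ 3) / 2| ≤ (l : ℝ) ^ 2 ∧
    |modeD l k - ((k : ℝ) * l ^ 2 - k ^ 3) / 2| ≤ 2 * (l : ℝ) ^ 2 ∧
    |modeU l k - ((l : ℝ) ^ 3 - 3 / 2 * k * l ^ 2 + k ^ 3 / 2)| ≤ 5 * (l : ℝ) ^ 2 ∧
    |modeZ l k - ((k : ℝ) * l ^ 2 + k ^ 3) / 2| ≤ 5 * (l : ℝ) ^ 2 := by
  have hx : (2 : ℝ) ≤ l := by exact_mod_cast hl
  have hk' : (k : ℝ) ≤ l := by exact_mod_cast hk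
  have hk0 : (0 : ℝ) ≤ k := Nat.cast_nonneg k
  simp only [modeU, modeZ, modeD]
  have hδ : 0 ≤ (if k = 0 then (1 : ℝ) else 0) ∧ (if k = 0 then (1 : ℝ) else 0) ≤ 1 := by
    split_ifs <;> norm_num
  generalize (if k = 0 then (1 : ℝ) else 0) = δ at hδ ⊢
  obtain ⟨hδ0, hδ1⟩ := hδ
  simp only [modeJ, sphEigenvalue]
  generalize (k : ℝ) = k at *
  generalize (l : ℝ) = x at *
  have hd : (0 : ℝ) < 2 * x + 1 := by linarith
  obtain ⟨s, hs⟩ : ∃ s, s = x * (x + 1) / (2 * x + 1) := ⟨_, rfl⟩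
  have hs0 : 0 ≤ s := by rw [hs]; positivity
  have hs1 : s ≤ x := by rw [hs, div_le_iff₀ hd]; nlinarith
  have he : (2 * (x * (x + 1)) + 1) / (2 * x + 1) = x + (x + 1) / (2 * x + 1) := by
    field_simp; ring
  obtain ⟨t, ht⟩ : ∃ t, t = (x + 1) / (2 * x + 1) := ⟨_, rfl⟩
  have ht0 : 0 ≤ t := by rw [ht]; positivity
  have ht1 : t ≤ 1 := by rw [ht, div_le_one hd]; linarith
  have hkx : 0 ≤ k * (x - 1) := mul_nonneg hk0 (by linarith)
  have hkx2 : k * (x - 1) ≤ x ^ 2 := by nlinarith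
  have hLd0 : 0 ≤ x * (x + 1) * δ := by positivity
  have hLd : x * (x + 1) * δ ≤ x * (x + 1) := mul_le_of_le_one_right (by positivity) hδ1
  have hLt0 : 0 ≤ x * (x + 1) * t := by positivity
  have hLt : x * (x + 1) * t ≤ x * (x + 1) := mul_le_of_le_one_right (by positivity) ht1
  have hk1 : 0 ≤ x * k := by positivity
  have hk2 : x * k ≤ x * x := by gcongr
  have hxx : 2 * x ≤ x * x := by nlinarith
  rw [mul_div_assoc 2 (x * (x + 1)), he, ← hs, ← ht]
  refine ⟨abs_le.2 ⟨?_, ?_⟩, abs_le.2 ⟨?_, ?_⟩, abs_le.2 ⟨?_, ?_⟩, abs_le.2 ⟨?_, ?_⟩⟩ <;>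
    linarith only [hs0, hs1, hkx, hkx2, hLd0, hLd, hLt0, hLt, hk1, hk2, hxx, hk0]

theorem cholRatio_bounds (hl : 2 ≤ l) :
    0 ≤ cholRatio l - 1 / 3 ∧ cholRatio l - 1 / 3 ≤ 1 / (l : ℝ) ^ 2 := by
  have hx : (2 : ℝ) ≤ l := by exact_mod_cast hl
  have h : cholRatio l - 1 / 3 = 8 / (3 * (3 * sphEigenvalue l - 2)) := by
    have := six_le_sphEigenvalue hl
    have h0 : 3 * sphEigenvalue l - 2 ≠ 0 := by linarith
    rw [cholRatio, div_sub_div _ _ h0 (by norm_num), div_eq_div_iff (by positivity)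
      (by positivity)]
    ring
  rw [h, sphEigenvalue]
  have h2 : 0 < 3 * ((l : ℝ) * (l + 1)) - 2 := by nlinarith
  refine ⟨by positivity, ?_⟩
  rw [div_le_div_iff₀ (by positivity) (by positivity)]
  nlinarith

theorem weightOne_bound (hl : 2 ≤ l) (hk : k ≤ l) :
    |weightOne l k - (1 / (l : ℝ) - k / (l : ℝ) ^ 2)| ≤ 1 / (l : ℝ) ^ 2 := by
  have hx : (2 : ℝ) ≤ l := by exact_mod_cast hl
  have hk' : (k : ℝ) ≤ l := by exact_mod_cast hk
  have hk0 : (0 : ℝ) ≤ k := Nat.cast_nonneg k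
  rw [weightOne, sphEigenvalue]
  generalize (k : ℝ) = k at *
  generalize (l : ℝ) = x at *
  have h : (2 * (x * (x + 1)) / (2 * x + 1) - k) / (x * (x + 1)) - (1 / x - k / x ^ 2) =
      k / (x + 1) / x ^ 2 - x / (2 * x + 1) / x ^ 2 := by
    field_simp; ring
  have h1 : k / (x + 1) ≤ 1 := by rw [div_le_one (by linarith)]; linarith
  have h2 : x / (2 * x + 1) ≤ 1 := by rw [div_le_one (by linarith)]; linarith
  have h3 : 0 ≤ k / (x + 1) := by positivity
  have h4 : 0 ≤ x / (2 * x + 1) := by positivity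
  rw [h, ← sub_div, abs_div, abs_of_pos (by positivity : 0 < x ^ 2)]
  gcongr
  rw [abs_le]; constructor <;> linarith

theorem weightTwo_bound (hl : 2 ≤ l) (hk : k ≤ l) :
    |weightTwo l k - k / (l : ℝ) ^ 2| ≤ 1 / (l : ℝ) ^ 2 := by
  have hx : (2 : ℝ) ≤ l := by exact_mod_cast hl
  have hk' : (k : ℝ) ≤ l := by exact_mod_cast hk
  have hk0 : (0 : ℝ) ≤ k := Nat.cast_nonneg k
  rw [weightTwo, sphEigenvalue]
  generalize (k : ℝ) = k at *
  generalize (l : ℝ) = x at *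
  have h : k / (x * (x + 1)) - k / x ^ 2 = -(k / (x + 1) / x ^ 2) := by
    field_simp; ring
  have h1 : k / (x + 1) ≤ 1 := by rw [div_le_one (by linarith)]; linarith
  rw [h, abs_neg, abs_of_nonneg (by positivity)]
  gcongr

theorem modeU_main_bound (hk : k ≤ l) :
    |(l : ℝ) ^ 3 - 3 / 2 * k * l ^ 2 + k ^ 3 / 2| ≤ 2 * (l : ℝ) ^ 3 := by
  have hk' : (k : ℝ) ≤ l := by exact_mod_cast hk
  have hk0 : (0 : ℝ) ≤ k := Nat.cast_nonneg k
  have h1 : (k : ℝ) ^ 3 ≤ l ^ 3 := by gcongr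
  have h2 : (k : ℝ) * l ^ 2 ≤ l * l ^ 2 := by gcongr
  have h3 : (0 : ℝ) ≤ k * l ^ 2 := by positivity
  have h4 : (0 : ℝ) ≤ (k : ℝ) ^ 3 := by positivity
  rw [abs_le]; constructor <;> nlinarith

theorem modeJ_main_bound (hk : k ≤ l) :
    |((k : ℝ) * l ^ 2 - k ^ 3) / 2| ≤ (l : ℝ) ^ 3 := by
  have hk' : (k : ℝ) ≤ l := by exact_mod_cast hk
  have hk0 : (0 : ℝ) ≤ k := Nat.cast_nonneg k
  have h1 : (k : ℝ) ^ 3 ≤ l ^ 3 := by gcongr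
  have h2 : (k : ℝ) * l ^ 2 ≤ l * l ^ 2 := by gcongr
  have h3 : (0 : ℝ) ≤ k * l ^ 2 := by positivity
  have h4 : (0 : ℝ) ≤ (k : ℝ) ^ 3 := by positivity
  rw [abs_le]; constructor <;> nlinarith

theorem modeZ_main_bound (hk : k ≤ l) :
    |((k : ℝ) * l ^ 2 + k ^ 3) / 2| ≤ (l : ℝ) ^ 3 := by
  have hk' : (k : ℝ) ≤ l := by exact_mod_cast hk
  have hk0 : (0 : ℝ) ≤ k := Nat.cast_nonneg k
  have h1 : (k : ℝ) ^ 3 ≤ l ^ 3 := by gcongr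
  have h2 : (k : ℝ) * l ^ 2 ≤ l * l ^ 2 := by gcongr
  have h3 : (0 : ℝ) ≤ k * l ^ 2 := by positivity
  have h4 : (0 : ℝ) ≤ (k : ℝ) ^ 3 := by positivity
  rw [abs_le]; constructor <;> nlinarith

theorem abs_div_le_of_pow_le {x n d c : ℝ} (hx : 0 < x) (hn : |n| ≤ c) (hd : x ^ 4 ≤ d) :
    |n / d| ≤ c / x ^ 4 := by
  have hx4 : 0 < x ^ 4 := by positivity
  rw [abs_div, abs_of_pos (hx4.trans_le hd)]
  exact div_le_div₀ ((abs_nonneg _).trans hn) hn hx4 hd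

/-- Since `λ - 2 = l² + (l - 2)`, the denominators with `λ - 2` are bounded below by pure powers of
`l`. -/
theorem sq_le_sphEigenvalue_sub (hl : 2 ≤ l) : (l : ℝ) ^ 2 ≤ sphEigenvalue l - 2 := by
  have hx : (2 : ℝ) ≤ l := by exact_mod_cast hl
  rw [sphEigenvalue]; linarith

theorem pow_four_le_mul (hl : 2 ≤ l) :
    (l : ℝ) ^ 4 ≤ sphEigenvalue l * (sphEigenvalue l - 2) := by
  have h := sq_le_sphEigenvalue_sub hl
  calc (l : ℝ) ^ 4 = (l : ℝ) ^ 2 * (l : ℝ) ^ 2 := by ring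
    _ ≤ sphEigenvalue l * (sphEigenvalue l - 2) := by
      gcongr
      · linarith [sq_nonneg (l : ℝ)]
      · linarith

theorem weightThree_bound (hl : 2 ≤ l) (hk : k ≤ l) :
    |weightThree l k - (4 / (3 * (l : ℝ)) - 2 * k / (l : ℝ) ^ 2
      + 2 * (k : ℝ) ^ 3 / (3 * (l : ℝ) ^ 4))| ≤ 100 / (l : ℝ) ^ 2 := by
  have hx : (2 : ℝ) ≤ l := by exact_mod_cast hl
  have hx0 : (0 : ℝ) < l := by linarith
  have hL := six_le_sphEigenvalue hl
  have hd : (l : ℝ) ^ 4 ≤ sphEigenvalue l * (sphEigenvalue l - 2 / 3) :=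
    (pow_four_le_mul hl).trans (mul_le_mul_of_nonneg_left (by linarith) (by linarith))
  have h := abs_mul_sub_mul_le hx0 (mode_bounds hl hk).2.2.1
    (abs_div_le_of_pow_le (n := 4 / 3) (c := 4 / 3) hx0 (by norm_num) hd) (modeU_main_bound hk)
    (abs_div_sub_div_le (n := 4 / 3) hx0 hd ((mul_le_mul_of_nonneg_left (by linarith)
      (by linarith)).trans (sphEigenvalue_sq_le hl)) (by norm_num))
  have e1 : weightThree l k =
      modeU l k * (4 / 3 / (sphEigenvalue l * (sphEigenvalue l - 2 / 3))) := by
    have h1 : sphEigenvalue l ≠ 0 := by linarith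
    have h2 : 3 * sphEigenvalue l - 2 ≠ 0 := by linarith
    have h3 : sphEigenvalue l - 2 / 3 ≠ 0 := by linarith
    have h4 : 3 * sphEigenvalue l - 2 = 3 * (sphEigenvalue l - 2 / 3) := by ring
    rw [weightThree, h4]; field_simp
  have e2 : 4 / (3 * (l : ℝ)) - 2 * k / (l : ℝ) ^ 2 + 2 * (k : ℝ) ^ 3 / (3 * (l : ℝ) ^ 4) =
      ((l : ℝ) ^ 3 - 3 / 2 * k * l ^ 2 + k ^ 3 / 2) * (4 / 3 / (l : ℝ) ^ 4) := by
    field_simp; ring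
  rw [e1, e2]
  refine h.trans ?_
  gcongr
  norm_num

theorem weightFour_bound (hl : 2 ≤ l) (hk : k ≤ l) :
    |weightFour l k - 2 * (k / (l : ℝ) ^ 2 - (k : ℝ) ^ 3 / (l : ℝ) ^ 4)| ≤
      100 / (l : ℝ) ^ 2 := by
  have hx : (2 : ℝ) ≤ l := by exact_mod_cast hl
  have hx0 : (0 : ℝ) < l := by linarith
  have hL := six_le_sphEigenvalue hl
  have hd := pow_four_le_mul hl
  have hj : |modeJ l k - ((k : ℝ) * l ^ 2 - k ^ 3) / 2| ≤ 1 * (l : ℝ) ^ 2 := by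
    rw [one_mul]; exact (mode_bounds hl hk).1
  have hj' : |((k : ℝ) * l ^ 2 - k ^ 3) / 2| ≤ 1 * (l : ℝ) ^ 3 := by
    rw [one_mul]; exact modeJ_main_bound hk
  have h := abs_mul_sub_mul_le hx0 hj
    (abs_div_le_of_pow_le (n := 4) (c := 4) hx0 (by norm_num) hd) hj'
    (abs_div_sub_div_le (n := 4) hx0 hd ((mul_le_mul_of_nonneg_left (by linarith)
      (by linarith)).trans (sphEigenvalue_sq_le hl)) (by norm_num))
  have e1 : weightFour l k =
      modeJ l k * (4 / (sphEigenvalue l * (sphEigenvalue l - 2))) := by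
    rw [weightFour]; ring
  have e2 : 2 * (k / (l : ℝ) ^ 2 - (k : ℝ) ^ 3 / (l : ℝ) ^ 4) =
      (((k : ℝ) * l ^ 2 - k ^ 3) / 2) * (4 / (l : ℝ) ^ 4) := by
    field_simp; ring
  rw [e1, e2]
  refine h.trans ?_
  gcongr
  norm_num

/-- Replacing the Cholesky ratio `1/3 + ε` by `1/3` costs only `ε |u₀| ≤ 2x ≤ x²`, within the
admitted error. -/
theorem abs_sub_ratio_mul_le {x u u₀ d d₀ ε a b : ℝ} (hx : 2 ≤ x) (h1 : |u - u₀| ≤ a * x ^ 2)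
    (h2 : |d - d₀| ≤ b * x ^ 2) (h3 : |u₀| ≤ 2 * x ^ 3) (hε : 0 ≤ ε) (hε' : ε ≤ 1 / x ^ 2) :
    |(d - (1 / 3 + ε) * u) - (d₀ - u₀ / 3)| ≤ (a + b + 1) * x ^ 2 := by
  have hx0 : 0 < x := by linarith
  have hε1 : ε ≤ 1 / 4 := hε'.trans (by
    rw [div_le_div_iff₀ (by positivity) (by norm_num)]; nlinarith)
  have h4 : |ε * u₀| ≤ x ^ 2 := by
    rw [abs_mul, abs_of_nonneg hε]
    calc ε * |u₀| ≤ 1 / x ^ 2 * (2 * x ^ 3) := by gcongr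
      _ = 2 * x := by field_simp
      _ ≤ x ^ 2 := by nlinarith
  have h5 : |(1 / 3 + ε) * (u - u₀)| ≤ a * x ^ 2 := by
    rw [abs_mul, abs_of_nonneg (by linarith)]
    calc (1 / 3 + ε) * |u - u₀| ≤ 1 * |u - u₀| := by gcongr; linarith
      _ ≤ a * x ^ 2 := by rw [one_mul]; exact h1
  rw [abs_le] at *
  constructor <;> linarith

theorem weightFive_bound (hl : 2 ≤ l) (hk : k ≤ l) :
    |weightFive l k - 1 / 6 * (1 / (l : ℝ) + 8 * (k : ℝ) ^ 3 / (l : ℝ) ^ 4)| ≤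
      1000 / (l : ℝ) ^ 2 := by
  have hx : (2 : ℝ) ≤ l := by exact_mod_cast hl
  have hx0 : (0 : ℝ) < l := by linarith
  obtain ⟨hε, hε'⟩ := cholRatio_bounds hl
  obtain ⟨-, hD, hU, hZ⟩ := mode_bounds hl hk
  have hL := six_le_sphEigenvalue hl
  have h0 := modeU_main_bound hk
  have h1 := modeJ_main_bound hk
  have h2 := modeZ_main_bound hk
  set U₀ : ℝ := (l : ℝ) ^ 3 - 3 / 2 * k * l ^ 2 + k ^ 3 / 2 with hU₀
  set D₀ : ℝ := ((k : ℝ) * l ^ 2 - k ^ 3) / 2 with hD₀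
  set Z₀ : ℝ := ((k : ℝ) * l ^ 2 + k ^ 3) / 2 with hZ₀
  -- The form `Z - 2ρD + ρ²U` is written as `(Z - ρD) - ρ(D - ρU)`, so the same comparison applies
  -- to each bracket and then to their combination.
  have h3 := abs_sub_ratio_mul_le hx hU hD h0 hε hε'
  have h4 := abs_sub_ratio_mul_le hx hD hZ (h1.trans (by nlinarith [pow_pos hx0 3])) hε hε'
  have h5 : |D₀ - U₀ / 3| ≤ 2 * (l : ℝ) ^ 3 := by
    rw [abs_le] at *
    constructor <;> linarith [pow_pos hx0 3]
  have h6 := abs_sub_ratio_mul_le hx h3 h4 h5 hε hε'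
  rw [add_sub_cancel] at h3 h4 h6
  have h7 : |Z₀ - D₀ / 3 - (D₀ - U₀ / 3) / 3| ≤ 3 * (l : ℝ) ^ 3 := by
    rw [abs_le] at *
    constructor <;> linarith [pow_pos hx0 3]
  have hd : (l : ℝ) ^ 4 ≤
      sphEigenvalue l ^ 2 * (sphEigenvalue l - 2) / (sphEigenvalue l - 2 / 3) := by
    have h8 := sq_le_sphEigenvalue_sub hl
    have h9 : (l : ℝ) ^ 4 + 2 * l ^ 3 + l ^ 2 = sphEigenvalue l ^ 2 := by
      rw [sphEigenvalue]; ring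
    have h10 : (2 * (l : ℝ) ^ 3 + l ^ 2) * l ^ 2 ≤
        (2 * (l : ℝ) ^ 3 + l ^ 2) * (sphEigenvalue l - 2) := by gcongr
    have h11 : 0 ≤ (l : ℝ) ^ 4 * (l - 2) := mul_nonneg (by positivity) (by linarith)
    rw [le_div_iff₀ (by linarith), ← h9]
    nlinarith only [h10, h11]
  have hd' : sphEigenvalue l ^ 2 * (sphEigenvalue l - 2) / (sphEigenvalue l - 2 / 3) ≤
      (l : ℝ) ^ 4 + 3 * (l : ℝ) ^ 3 := by
    refine le_trans ?_ (sphEigenvalue_sq_le hl)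
    rw [div_le_iff₀ (by linarith), ← sq]
    gcongr
    norm_num
  have h := abs_mul_sub_mul_le hx0 h6
    (abs_div_le_of_pow_le (n := 3 / 2) (c := 3 / 2) hx0 (by norm_num) hd) h7
    (abs_div_sub_div_le (n := 3 / 2) hx0 hd hd' (by norm_num))
  have e1 : weightFive l k =
      (modeZ l k - cholRatio l * modeD l k - cholRatio l * (modeD l k - cholRatio l * modeU l k)) *
        (3 / 2 / (sphEigenvalue l ^ 2 * (sphEigenvalue l - 2) / (sphEigenvalue l - 2 / 3))) := by
    have h1 : sphEigenvalue l ≠ 0 := by linarith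
    have h2 : sphEigenvalue l - 2 ≠ 0 := by linarith
    have h3 : sphEigenvalue l - 2 / 3 ≠ 0 := by linarith
    rw [weightFive]
    generalize sphEigenvalue l ^ 2 * (sphEigenvalue l - 2) = W
    rw [div_div_eq_mul_div]
    ring
  have e2 : 1 / 6 * (1 / (l : ℝ) + 8 * (k : ℝ) ^ 3 / (l : ℝ) ^ 4) =
      (Z₀ - D₀ / 3 - (D₀ - U₀ / 3) / 3) * (3 / 2 / (l : ℝ) ^ 4) := by
    rw [hZ₀, hD₀, hU₀]
    field_simp; ring
  rw [e1, e2]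
  refine h.trans ?_
  gcongr
  norm_num

theorem weightCross_bound (hl : 2 ≤ l) (hk : k ≤ l) :
    |weightCross l k - √2 / 3 * (-(1 / (l : ℝ)) + 3 * k / (l : ℝ) ^ 2
      - 2 * (k : ℝ) ^ 3 / (l : ℝ) ^ 4)| ≤ 1000 / (l : ℝ) ^ 2 := by
  have hx : (2 : ℝ) ≤ l := by exact_mod_cast hl
  have hx0 : (0 : ℝ) < l := by linarith
  obtain ⟨hε, hε'⟩ := cholRatio_bounds hl
  obtain ⟨-, hD, hU, -⟩ := mode_bounds hl hk
  have hL := six_le_sphEigenvalue hl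
  have h0 := modeU_main_bound hk
  have h1 := modeJ_main_bound hk
  set U₀ : ℝ := (l : ℝ) ^ 3 - 3 / 2 * k * l ^ 2 + k ^ 3 / 2 with hU₀
  set D₀ : ℝ := ((k : ℝ) * l ^ 2 - k ^ 3) / 2 with hD₀
  have h3 := abs_sub_ratio_mul_le hx hU hD h0 hε hε'
  rw [add_sub_cancel] at h3
  have h5 : |D₀ - U₀ / 3| ≤ 2 * (l : ℝ) ^ 3 := by
    rw [abs_le] at *
    constructor <;> linarith [pow_pos hx0 3]
  have hsub := sq_le_sphEigenvalue_sub hl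
  have hs1 : (l : ℝ) ≤ √(sphEigenvalue l - 2) := Real.le_sqrt_of_sq_le hsub
  have hs2 : √(sphEigenvalue l - 2) ≤ √(sphEigenvalue l) := Real.sqrt_le_sqrt (by linarith)
  -- The denominator is squeezed between `l⁴` and `λ²`, since `l ≤ √(λ - 2) ≤ √λ`.
  have hd : (l : ℝ) ^ 4 ≤
      sphEigenvalue l * √(sphEigenvalue l) * √(sphEigenvalue l - 2) := by
    calc (l : ℝ) ^ 4 = (l : ℝ) ^ 2 * l * l := by ring
      _ ≤ _ := by gcongr <;> linarith
  have hd' : sphEigenvalue l * √(sphEigenvalue l) * √(sphEigenvalue l - 2) ≤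
      (l : ℝ) ^ 4 + 3 * (l : ℝ) ^ 3 := by
    calc sphEigenvalue l * √(sphEigenvalue l) * √(sphEigenvalue l - 2)
        ≤ sphEigenvalue l * √(sphEigenvalue l) * √(sphEigenvalue l) := by gcongr
      _ = sphEigenvalue l * sphEigenvalue l := by
        rw [mul_assoc, Real.mul_self_sqrt (by linarith)]
      _ ≤ _ := sphEigenvalue_sq_le hl
  have h2 : √2 ≤ 2 := by rw [Real.sqrt_le_left (by norm_num)]; norm_num
  have h := abs_mul_sub_mul_le hx0 h3
    (abs_div_le_of_pow_le (n := √2) (c := 2) hx0 (by rwa [abs_of_nonneg (by positivity)]) hd) h5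
    (abs_div_sub_div_le (n := √2) hx0 hd hd' (by positivity))
  have e1 : weightCross l k = (modeD l k - cholRatio l * modeU l k) *
      (√2 / (sphEigenvalue l * √(sphEigenvalue l) * √(sphEigenvalue l - 2))) := by
    rw [weightCross]; ring
  have e2 : √2 / 3 * (-(1 / (l : ℝ)) + 3 * k / (l : ℝ) ^ 2 - 2 * (k : ℝ) ^ 3 / (l : ℝ) ^ 4) =
      (D₀ - U₀ / 3) * (√2 / (l : ℝ) ^ 4) := by
    rw [hD₀, hU₀]
    field_simp; ring
  rw [e1, e2]
  refine h.trans ?_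
  gcongr
  linarith

end Weights

/-! ### Sums of the limit weights and the Gaussian moments -/

section Remainder

theorem sum_Icc_neg_abs (l : ℕ) (A B C : ℝ) :
    ∑ m ∈ Finset.Icc (-(l : ℤ)) (l : ℤ), (A + B * |(m : ℝ)| + C * |(m : ℝ)| ^ 3) =
      A * (2 * l + 1) + B * (l * (l + 1)) + C * ((l : ℝ) ^ 2 * (l + 1) ^ 2 / 2) := by
  induction l with
  | zero => simp
  | succ n ih =>
    have h1 : Finset.Icc (-((n + 1 : ℕ) : ℤ)) ((n + 1 : ℕ) : ℤ) =
        insert (-((n : ℤ) + 1)) (insert ((n : ℤ) + 1) (Finset.Icc (-(n : ℤ)) (n : ℤ))) := by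
      ext m
      simp only [Finset.mem_Icc, Finset.mem_insert]
      omega
    have h2 : |(n : ℝ) + 1| = n + 1 := abs_of_nonneg (by positivity)
    rw [h1, Finset.sum_insert (by simp only [Finset.mem_Icc, Finset.mem_insert]; omega),
      Finset.sum_insert (by simp only [Finset.mem_Icc]; omega), ih]
    push_cast
    rw [abs_neg, h2]
    ring

theorem integrable_pow_four_gaussianReal (v : NNReal) :
    Integrable (fun x : ℝ => x ^ 4) (gaussianReal 0 v) := by
  have h := (memLp_id_gaussianReal (μ := 0) (v := v) 4).integrable_norm_pow (p := 4) (by norm_num)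
  refine h.congr (Filter.Eventually.of_forall fun x => ?_)
  simp only [id, Real.norm_eq_abs]
  exact (by decide : Even 4).pow_abs x

/-- The fourth moment of the centred Gaussian law of variance `v`. -/
noncomputable def fourthMoment (v : NNReal) : ℝ := ∫ x, x ^ 4 ∂(gaussianReal 0 v)

theorem fourthMoment_nonneg (v : NNReal) : 0 ≤ fourthMoment v :=
  integral_nonneg fun x => by positivity

variable {Ω : Type*} [MeasurableSpace Ω] {P : Measure Ω}

theorem integrable_pow_four_of_hasLaw {X : Ω → ℝ} {v : NNReal}
    (h : HasLaw X (gaussianReal 0 v) P) : Integrable (fun ω => X ω ^ 4) P := by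
  have h1 := integrable_pow_four_gaussianReal v
  rw [← h.map_eq] at h1
  exact h1.comp_aemeasurable h.aemeasurable

theorem integral_pow_four_of_hasLaw {X : Ω → ℝ} {v : NNReal}
    (h : HasLaw X (gaussianReal 0 v) P) : ∫ ω, X ω ^ 4 ∂P = fourthMoment v := by
  rw [fourthMoment, ← h.map_eq, integral_map h.aemeasurable (by fun_prop)]

/-- A bound for the second moments of `|a|² - 1`. -/
noncomputable def momentBound : ℝ := 3 * (2 * fourthMoment (1 / 2) + fourthMoment 1 + 1)

theorem momentBound_nonneg : 0 ≤ momentBound := by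
  have h1 := fourthMoment_nonneg (1 / 2)
  have h2 := fourthMoment_nonneg 1
  unfold momentBound
  positivity

variable [IsProbabilityMeasure P] {l : ℕ} {a : ℤ → Ω → ℂ}

theorem sq_norm_sub_one_moment_of {z : Ω → ℂ} {M : ℝ}
    (hr : AEMeasurable (fun ω => (z ω).re) P) (hi : AEMeasurable (fun ω => (z ω).im) P)
    (hr4 : Integrable (fun ω => (z ω).re ^ 4) P) (hi4 : Integrable (fun ω => (z ω).im ^ 4) P)
    (hM : 3 * ((∫ ω, (z ω).re ^ 4 ∂P) + (∫ ω, (z ω).im ^ 4 ∂P) + 1) ≤ M) :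
    MemLp (fun ω => ‖z ω‖ ^ 2 - 1) 2 P ∧ ∫ ω, (‖z ω‖ ^ 2 - 1) ^ 2 ∂P ≤ M := by
  have hz : ∀ ω, ‖z ω‖ ^ 2 = (z ω).re ^ 2 + (z ω).im ^ 2 := fun ω => by
    rw [← Complex.normSq_eq_norm_sq, Complex.normSq_apply]; ring
  simp only [hz]
  have hm : AEStronglyMeasurable (fun ω => (z ω).re ^ 2 + (z ω).im ^ 2 - 1) P :=
    (((hr.pow_const 2).add (hi.pow_const 2)).sub_const 1).aestronglyMeasurable
  have hg : Integrable (fun ω => 3 * ((z ω).re ^ 4 + (z ω).im ^ 4 + 1)) P :=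
    ((hr4.add hi4).add (integrable_const 1)).const_mul 3
  have hle : ∀ ω, ((z ω).re ^ 2 + (z ω).im ^ 2 - 1) ^ 2 ≤
      3 * ((z ω).re ^ 4 + (z ω).im ^ 4 + 1) := fun ω => by
    -- This is `(p + q + r)² ≤ 3 (p² + q² + r²)` with `p = re²`, `q = im²`, `r = -1`.
    nlinarith [sq_nonneg ((z ω).re ^ 2 - (z ω).im ^ 2), sq_nonneg ((z ω).re ^ 2 + 1),
      sq_nonneg ((z ω).im ^ 2 + 1)]
  have hint : Integrable (fun ω => ((z ω).re ^ 2 + (z ω).im ^ 2 - 1) ^ 2) P :=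
    hg.mono' (hm.pow 2) (Filter.Eventually.of_forall fun ω => by
      rw [Real.norm_of_nonneg (sq_nonneg _)]; exact hle ω)
  refine ⟨(memLp_two_iff_integrable_sq hm).2 hint, (integral_mono hint hg hle).trans ?_⟩
  have h34 : Integrable (fun ω => (z ω).re ^ 4 + (z ω).im ^ 4) P := hr4.add hi4
  rw [integral_const_mul, integral_add h34 (integrable_const 1),
    integral_add hr4 hi4]
  simpa using hM

/-- At `m = 0` the symmetry makes the imaginary part vanish almost surely. `momentBound` adds the
fourth moments of both cases, so one constant serves every mode. -/
theorem IsGaussianHarmonicCoeff.moment (ha : IsGaussianHarmonicCoeff P l a) {m : ℤ}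
    (hm : |m| ≤ (l : ℤ)) :
    MemLp (fun ω => ‖a m ω‖ ^ 2 - 1) 2 P ∧
      ∫ ω, (‖a m ω‖ ^ 2 - 1) ^ 2 ∂P ≤ momentBound := by
  have h1 := fourthMoment_nonneg (1 / 2)
  have h2 := fourthMoment_nonneg 1
  rcases eq_or_ne m 0 with rfl | h0
  · have him : (fun ω => (a 0 ω).im) =ᵐ[P] fun _ => 0 := by
      filter_upwards [ha.conj_symm 0 hm] with ω hω
      have := congrArg Complex.im hω
      simp at this
      linarith
    have him4 : (fun ω => (a 0 ω).im ^ 4) =ᵐ[P] fun _ => 0 := by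
      filter_upwards [him] with ω hω
      rw [hω]; norm_num
    refine sq_norm_sub_one_moment_of ha.zero_law.aemeasurable
      (aemeasurable_const.congr him.symm) (integrable_pow_four_of_hasLaw ha.zero_law)
      ((integrable_zero _ _ _).congr him4.symm) ?_
    rw [integral_pow_four_of_hasLaw ha.zero_law, integral_congr_ae him4, momentBound]
    simp only [integral_zero]
    linarith
  · have hr := ha.re_law m hm h0
    have hi := ha.im_law m hm h0
    refine sq_norm_sub_one_moment_of hr.aemeasurable hi.aemeasurable
      (integrable_pow_four_of_hasLaw hr) (integrable_pow_four_of_hasLaw hi) ?_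
    rw [integral_pow_four_of_hasLaw hr, integral_pow_four_of_hasLaw hi, momentBound]
    linarith

/-- A linear combination of square integrable variables: a crude bound in mean square. -/
theorem integral_sq_sum_add_le {ι : Type*} (s : Finset ι) {X : ι → Ω → ℝ} {d : ι → ℝ}
    {e M N : ℝ} (hX : ∀ i ∈ s, MemLp (X i) 2 P) (hM : ∀ i ∈ s, ∫ ω, X i ω ^ 2 ∂P ≤ M)
    (hd : ∑ i ∈ s, d i ^ 2 ≤ N) :
    MemLp (fun ω => ∑ i ∈ s, X i ω * d i + e) 2 P ∧
      ∫ ω, (∑ i ∈ s, X i ω * d i + e) ^ 2 ∂P ≤ 2 * (N * (s.card * M)) + 2 * e ^ 2 := by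
  have hmem : MemLp (fun ω => ∑ i ∈ s, X i ω * d i + e) 2 P :=
    (memLp_finsetSum s fun i hi => (hX i hi).mul_const (d i)).add (memLp_const e)
  refine ⟨hmem, ?_⟩
  have hint : Integrable (fun ω => ∑ i ∈ s, X i ω ^ 2) P :=
    integrable_finsetSum s fun i hi => (hX i hi).integrable_sq
  have hle : ∀ ω, (∑ i ∈ s, X i ω * d i + e) ^ 2 ≤
      2 * (N * ∑ i ∈ s, X i ω ^ 2) + 2 * e ^ 2 := fun ω => by
    -- Cauchy–Schwarz pointwise in `ω`, then `(S + e)² ≤ 2 S² + 2 e²`.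
    have h1 := Finset.sum_mul_sq_le_sq_mul_sq s (fun i => X i ω) d
    have h2 : (∑ i ∈ s, X i ω ^ 2) * ∑ i ∈ s, d i ^ 2 ≤ (∑ i ∈ s, X i ω ^ 2) * N :=
      mul_le_mul_of_nonneg_left hd (Finset.sum_nonneg fun i _ => sq_nonneg _)
    nlinarith [sq_nonneg (∑ i ∈ s, X i ω * d i - e)]
  have hN : 0 ≤ N := (Finset.sum_nonneg fun i _ => sq_nonneg (d i)).trans hd
  calc ∫ ω, (∑ i ∈ s, X i ω * d i + e) ^ 2 ∂P
      ≤ ∫ ω, (2 * (N * ∑ i ∈ s, X i ω ^ 2) + 2 * e ^ 2) ∂P :=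
        integral_mono hmem.integrable_sq
          (((hint.const_mul N).const_mul 2).add (integrable_const _)) hle
    _ = 2 * (N * ∑ i ∈ s, ∫ ω, X i ω ^ 2 ∂P) + 2 * e ^ 2 := by
        rw [integral_add ((hint.const_mul N).const_mul 2) (integrable_const _),
          integral_const_mul, integral_const_mul,
          integral_finsetSum s fun i hi => (hX i hi).integrable_sq]
        simp
    _ ≤ 2 * (N * (s.card * M)) + 2 * e ^ 2 := by
        gcongr
        rw [← nsmul_eq_mul]
        exact Finset.sum_le_card_nsmul s _ _ hM

/-- The difference between a weighted sum of the `|c_m|²` with exact weights `w` and mean `t`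
and the centred sum with the limit weights `v`. -/
noncomputable def remainder (l : ℕ) (w : ℕ → ℝ) (v : ℝ → ℝ) (t : ℝ) (c : ℤ → ℂ) : ℝ :=
  4 * Real.pi * ∑ m ∈ Finset.Icc (-(l : ℤ)) (l : ℤ), ‖c m‖ ^ 2 * w m.natAbs - 4 * Real.pi * t
    - 4 * Real.pi * coeffSum l c v

theorem natAbs_cast_eq_abs (m : ℤ) : (m.natAbs : ℝ) = |(m : ℝ)| := by
  rw [Nat.cast_natAbs, Int.cast_abs]

/-- Writing `|c_m|² = (|c_m|² - 1) + 1` separates the fluctuation, weighted by the error `w - v`,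
from the deterministic defect `∑ w - t`. -/
theorem remainder_eq (l : ℕ) (w : ℕ → ℝ) (v : ℝ → ℝ) (t : ℝ) (c : ℤ → ℂ) :
    remainder l w v t c = 4 * Real.pi * (∑ m ∈ Finset.Icc (-(l : ℤ)) (l : ℤ),
      (‖c m‖ ^ 2 - 1) * (w m.natAbs - v m.natAbs)
        + (∑ m ∈ Finset.Icc (-(l : ℤ)) (l : ℤ), w m.natAbs - t)) := by
  have h : ∑ m ∈ Finset.Icc (-(l : ℤ)) (l : ℤ), (‖c m‖ ^ 2 - 1) * (w m.natAbs - v m.natAbs) =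
      ∑ m ∈ Finset.Icc (-(l : ℤ)) (l : ℤ), ‖c m‖ ^ 2 * w m.natAbs
      - ∑ m ∈ Finset.Icc (-(l : ℤ)) (l : ℤ), w m.natAbs - coeffSum l c v := by
    rw [coeffSum, ← Finset.sum_sub_distrib, ← Finset.sum_sub_distrib]
    refine Finset.sum_congr rfl fun m _ => ?_
    rw [natAbs_cast_eq_abs]; ring
  rw [remainder, h]
  ring

/-- The constant in the mean square bound of the remainders. -/
noncomputable def remainderConst : ℝ :=
  4 * Real.pi * √(2 * (9 * 1000 ^ 2 * momentBound) + 2 * 3003 ^ 2)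

theorem memLp_remainder (hl : 2 ≤ l) (ha : IsGaussianHarmonicCoeff P l a) {w : ℕ → ℝ}
    {v : ℝ → ℝ} {t : ℝ} (hw : ∀ k ≤ l, |w k - v k| ≤ 1000 / (l : ℝ) ^ 2)
    (ht : |∑ m ∈ Finset.Icc (-(l : ℤ)) (l : ℤ), v |(m : ℝ)| - t| ≤ 3 / l) :
    MemLp (fun ω => remainder l w v t fun m => a m ω) 2 P ∧
      √(∫ ω, (remainder l w v t fun m => a m ω) ^ 2 ∂P) ≤ remainderConst / l := by
  have hx : (2 : ℝ) ≤ l := by exact_mod_cast hl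
  have hx0 : (0 : ℝ) < l := by linarith
  have hcard : ((Finset.Icc (-(l : ℤ)) (l : ℤ)).card : ℝ) ≤ 3 * l := by
    rw [Int.card_Icc]
    have : ((l : ℤ) + 1 - -(l : ℤ)).toNat = 2 * l + 1 := by omega
    rw [this]; push_cast; linarith
  have hmem : ∀ m ∈ Finset.Icc (-(l : ℤ)) (l : ℤ), |m| ≤ (l : ℤ) ∧ m.natAbs ≤ l := fun m hm => by
    have := abs_le.2 (Finset.mem_Icc.1 hm)
    rw [Finset.mem_Icc] at hm
    exact ⟨this, by omega⟩
  have hd : ∑ m ∈ Finset.Icc (-(l : ℤ)) (l : ℤ), (w m.natAbs - v m.natAbs) ^ 2 ≤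
      3 * l * (1000 / (l : ℝ) ^ 2) ^ 2 := by
    refine (Finset.sum_le_card_nsmul _ _ _ fun m hm =>
      (sq_abs (w m.natAbs - v m.natAbs)).symm.le.trans
        (pow_le_pow_left₀ (abs_nonneg _) (hw _ (hmem m hm).2) 2)).trans ?_
    rw [nsmul_eq_mul]
    gcongr
  -- At most `3 l` modes, each with error `1000 / l²`, give `3000 / l`; the defect of the limit
  -- weights adds `3 / l`.
  have he : |∑ m ∈ Finset.Icc (-(l : ℤ)) (l : ℤ), w m.natAbs - t| ≤ 3003 / l := by
    have h1 : ∑ m ∈ Finset.Icc (-(l : ℤ)) (l : ℤ), w m.natAbs - t =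
        ∑ m ∈ Finset.Icc (-(l : ℤ)) (l : ℤ), (w m.natAbs - v m.natAbs)
          + (∑ m ∈ Finset.Icc (-(l : ℤ)) (l : ℤ), v |(m : ℝ)| - t) := by
      rw [Finset.sum_sub_distrib]
      simp only [natAbs_cast_eq_abs]
      ring
    have h2 : |∑ m ∈ Finset.Icc (-(l : ℤ)) (l : ℤ), (w m.natAbs - v m.natAbs)| ≤
        3 * l * (1000 / (l : ℝ) ^ 2) := by
      refine (Finset.abs_sum_le_sum_abs _ _).trans
        ((Finset.sum_le_card_nsmul _ _ _ fun m hm => hw _ (hmem m hm).2).trans ?_)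
      rw [nsmul_eq_mul]
      gcongr
    rw [h1]
    refine (abs_add_le _ _).trans ((add_le_add h2 ht).trans (le_of_eq ?_))
    field_simp; norm_num
  obtain ⟨h1, h2⟩ := integral_sq_sum_add_le (P := P) (Finset.Icc (-(l : ℤ)) (l : ℤ))
    (X := fun m ω => ‖a m ω‖ ^ 2 - 1) (d := fun m => w m.natAbs - v m.natAbs)
    (e := ∑ m ∈ Finset.Icc (-(l : ℤ)) (l : ℤ), w m.natAbs - t)
    (fun m hm => (ha.moment (hmem m hm).1).1) (fun m hm => (ha.moment (hmem m hm).1).2) hd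
  simp only [remainder_eq]
  refine ⟨h1.const_mul _, ?_⟩
  simp only [mul_pow (4 * Real.pi)]
  have hM := momentBound_nonneg
  rw [integral_const_mul, Real.sqrt_mul (sq_nonneg _), Real.sqrt_sq (by positivity),
    remainderConst, mul_div_assoc]
  gcongr
  rw [Real.sqrt_le_left (by positivity), div_pow, Real.sq_sqrt (by positivity)]
  refine h2.trans ?_
  have he2 : (∑ m ∈ Finset.Icc (-(l : ℤ)) (l : ℤ), w m.natAbs - t) ^ 2 ≤ (3003 / l) ^ 2 := by
    rw [← sq_abs]; gcongr
  calc _ ≤ 2 * (3 * l * (1000 / (l : ℝ) ^ 2) ^ 2 * (3 * l * momentBound))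
        + 2 * (3003 / (l : ℝ)) ^ 2 := by gcongr
    _ = (2 * (9 * 1000 ^ 2 * momentBound) + 2 * 3003 ^ 2) / (l : ℝ) ^ 2 := by
        field_simp; ring

end Remainder

/-! ### The six families of weights, their sums, and the conclusion. -/

section Final

theorem coeffSum_const_mul (l : ℕ) (c : ℤ → ℂ) (b : ℝ) (w : ℝ → ℝ) :
    coeffSum l c (fun k => b * w k) = b * coeffSum l c w := by
  rw [coeffSum, coeffSum, Finset.mul_sum]
  exact Finset.sum_congr rfl fun m _ => by ring

/-- The exact weights of the modes in `A₃₅, B₁, …, B₅`. -/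
noncomputable def exactWeight (l : ℕ) : Fin 6 → ℕ → ℝ :=
  ![weightCross l, weightOne l, weightTwo l, weightThree l, weightFour l, weightFive l]

/-- The limit weights of the modes in `A₃₅, B₁, …, B₅`. -/
noncomputable def limitWeight (l : ℕ) : Fin 6 → ℝ → ℝ :=
  ![fun k => √2 / 3 * (-(1 / (l : ℝ)) + 3 * k / (l : ℝ) ^ 2 - 2 * k ^ 3 / (l : ℝ) ^ 4),
    fun k => 1 / (l : ℝ) - k / (l : ℝ) ^ 2,
    fun k => k / (l : ℝ) ^ 2,
    fun k => 4 / (3 * (l : ℝ)) - 2 * k / (l : ℝ) ^ 2 + 2 * k ^ 3 / (3 * (l : ℝ) ^ 4),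
    fun k => 2 * (k / (l : ℝ) ^ 2 - k ^ 3 / (l : ℝ) ^ 4),
    fun k => 1 / 6 * (1 / (l : ℝ) + 8 * k ^ 3 / (l : ℝ) ^ 4)]

/-- The normalization of the sums of the weights. -/
noncomputable def weightMean : Fin 6 → ℝ := ![0, 1, 1, 1, 1, 1]

theorem exactWeight_bound {l : ℕ} (hl : 2 ≤ l) (i : Fin 6) (k : ℕ) (hk : k ≤ l) :
    |exactWeight l i k - limitWeight l i k| ≤ 1000 / (l : ℝ) ^ 2 := by
  have h1 : 1 / (l : ℝ) ^ 2 ≤ 1000 / (l : ℝ) ^ 2 := by gcongr; norm_num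
  have h2 : 100 / (l : ℝ) ^ 2 ≤ 1000 / (l : ℝ) ^ 2 := by gcongr; norm_num
  fin_cases i
  · exact weightCross_bound hl hk
  · exact (weightOne_bound hl hk).trans h1
  · exact (weightTwo_bound hl hk).trans h1
  · exact (weightThree_bound hl hk).trans h2
  · exact (weightFour_bound hl hk).trans h2
  · exact weightFive_bound hl hk

theorem abs_sum_sub_le {l : ℕ} {v : ℝ → ℝ} {t r : ℝ} (A B C : ℝ)
    (hv : ∀ k, v k = A + B * k + C * k ^ 3)
    (h : A * (2 * l + 1) + B * (l * (l + 1)) + C * ((l : ℝ) ^ 2 * (l + 1) ^ 2 / 2) - t = r)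
    (hr : |r| ≤ 3 / l) :
    |∑ m ∈ Finset.Icc (-(l : ℤ)) (l : ℤ), v |(m : ℝ)| - t| ≤ 3 / l := by
  simp only [hv, sum_Icc_neg_abs]
  rwa [h]

/-- The limit weights are combinations of `1`, `|m|`, `|m|³`, so their sums are exact, and `r` in
each case is the defect. The mean is `1` for the `B_i`, matching the term `-1` of `H_2`, and `0` for
the product `Y₃ Y₅`. -/
theorem limitWeight_sum {l : ℕ} (hl : 2 ≤ l) (i : Fin 6) :
    |∑ m ∈ Finset.Icc (-(l : ℤ)) (l : ℤ), limitWeight l i |(m : ℝ)| - weightMean i| ≤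
      3 / l := by
  have hx : (2 : ℝ) ≤ l := by exact_mod_cast hl
  have hx0 : (0 : ℝ) < l := by linarith
  have hy0 : 0 ≤ 1 / (l : ℝ) := by positivity
  have hy : 1 / (l : ℝ) ≤ 1 / 2 := by gcongr
  have hy2 : 3 / (l : ℝ) = 3 * (1 / l) := by ring
  fin_cases i
  · refine abs_sum_sub_le (r := -(√2 / 3) * (1 / l) ^ 2)
      (√2 / 3 * -(1 / (l : ℝ))) (√2 / 3 * (3 / (l : ℝ) ^ 2))
      (√2 / 3 * -(2 / (l : ℝ) ^ 4)) (fun k => ?_) ?_ ?_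
    · simp [limitWeight]; ring
    · simp [weightMean]; field_simp; ring
    · have h2 : √2 ≤ 2 := by rw [Real.sqrt_le_left (by norm_num)]; norm_num
      rw [hy2, neg_mul, abs_neg, abs_of_nonneg (by positivity)]
      have h3 : √2 / 3 * (1 / (l : ℝ)) ^ 2 ≤ 1 * (1 / (l : ℝ)) ^ 2 := by gcongr; linarith
      nlinarith
  · refine abs_sum_sub_le (r := 0) (1 / (l : ℝ)) (-(1 / (l : ℝ) ^ 2)) 0 (fun k => ?_) ?_ ?_
    · simp [limitWeight]; ring
    · simp [weightMean]; field_simp; ring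
    · rw [abs_zero]; positivity
  · refine abs_sum_sub_le (r := 1 / l) 0 (1 / (l : ℝ) ^ 2) 0 (fun k => ?_) ?_ ?_
    · simp [limitWeight]; ring
    · simp [weightMean]; field_simp; ring
    · rw [abs_of_nonneg hy0, hy2]; linarith
  · refine abs_sum_sub_le (r := (1 / l) ^ 2 / 3) (4 / (3 * (l : ℝ))) (-(2 / (l : ℝ) ^ 2))
      (2 / (3 * (l : ℝ) ^ 4)) (fun k => ?_) ?_ ?_
    · simp [limitWeight]; ring
    · simp [weightMean]; field_simp; ring
    · rw [abs_of_nonneg (by positivity), hy2]; nlinarith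
  · refine abs_sum_sub_le (r := -(1 / l) ^ 2) 0 (2 / (l : ℝ) ^ 2)
      (-(2 / (l : ℝ) ^ 4)) (fun k => ?_) ?_ ?_
    · simp [limitWeight]; ring
    · simp [weightMean]; field_simp; ring
    · rw [abs_neg, abs_of_nonneg (by positivity), hy2]; nlinarith
  · refine abs_sum_sub_le (r := 3 / 2 * (1 / l) + 2 / 3 * (1 / l) ^ 2) (1 / 6 * (1 / (l : ℝ))) 0
      (1 / 6 * (8 / (l : ℝ) ^ 4)) (fun k => ?_) ?_ ?_
    · simp [limitWeight]; ring
    · simp [weightMean]; field_simp; ring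
    · rw [abs_of_nonneg (by positivity), hy2]; nlinarith

end Final

theorem proposition4 :
    ∃ C : ℝ, ∀ (Ω : Type*) [MeasurableSpace Ω] (P : Measure Ω) [IsProbabilityMeasure P]
      (l : ℕ) (a : ℤ → Ω → ℂ), 2 ≤ l → IsGaussianHarmonicCoeff P l a →
      -- all the integrals over the sphere converge
      (∀ᵐ ω ∂P,
        SphIntegrable (fun θ φ =>
          normVec l (fun m => a m ω) θ φ 2 * normVec l (fun m => a m ω) θ φ 4) ∧
        ∀ i : Fin 5, SphIntegrable (fun θ φ => hermiteTwo (normVec l (fun m => a m ω) θ φ i))) ∧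
      ∃ r : Fin 6 → Ω → ℝ,
        (∀ i, MemLp (r i) 2 P ∧ √(∫ ω, r i ω ^ 2 ∂P) ≤ C / (l : ℝ)) ∧
        ∀ᵐ ω ∂P,
          crossInt l (fun m => a m ω) 2 4 =
              4 * Real.pi * (√2 / 3) * coeffSum l (fun m => a m ω)
                (fun k => -(1 / (l : ℝ)) + 3 * k / (l : ℝ) ^ 2 - 2 * k ^ 3 / (l : ℝ) ^ 4)
              + r 0 ω ∧
          hermiteInt l (fun m => a m ω) 0 =
              4 * Real.pi * coeffSum l (fun m => a m ω)
                (fun k => 1 / (l : ℝ) - k / (l : ℝ) ^ 2)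
              + r 1 ω ∧
          hermiteInt l (fun m => a m ω) 1 =
              4 * Real.pi * coeffSum l (fun m => a m ω)
                (fun k => k / (l : ℝ) ^ 2)
              + r 2 ω ∧
          hermiteInt l (fun m => a m ω) 2 =
              4 * Real.pi * coeffSum l (fun m => a m ω)
                (fun k => 4 / (3 * (l : ℝ)) - 2 * k / (l : ℝ) ^ 2
                  + 2 * k ^ 3 / (3 * (l : ℝ) ^ 4))
              + r 3 ω ∧
          hermiteInt l (fun m => a m ω) 3 =
              4 * Real.pi * 2 * coeffSum l (fun m => a m ω)
                (fun k => k / (l : ℝ) ^ 2 - k ^ 3 / (l : ℝ) ^ 4)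
              + r 4 ω ∧
          hermiteInt l (fun m => a m ω) 4 =
              4 * Real.pi * (1 / 6) * coeffSum l (fun m => a m ω)
                (fun k => 1 / (l : ℝ) + 8 * k ^ 3 / (l : ℝ) ^ 4)
              + r 5 ω := by
  refine ⟨remainderConst, fun Ω _ P _ l a hl ha => ?_⟩
  -- There are countably many `m`, so the symmetries hold simultaneously off one null set.
  have hc : ∀ᵐ ω ∂P, ∀ m : ℤ, |m| ≤ (l : ℤ) →
      (-1 : ℂ) ^ m * a (-m) ω = (starRingEnd ℂ) (a m ω) :=
    ae_all_iff.2 fun m => ae_all_iff.2 fun hm => ha.conj_symm m hm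
  refine ⟨Filter.Eventually.of_forall fun ω => ⟨?_, fun i => ?_⟩,
    -- The remainder is by definition exact form minus main term, so the six identities reduce to
    -- the exact formulas for the integrals.
    fun i ω => remainder l (exactWeight l i) (limitWeight l i) (weightMean i) fun m => a m ω,
    fun i => memLp_remainder hl ha (exactWeight_bound hl i) (limitWeight_sum hl i), ?_⟩
  · exact sphIntegrable_mul (normVec_two hl) (normVec_four hl) (fun k => by fun_prop)
      (fun k => by fun_prop)
  · fin_cases i
    · exact sphIntegrable_hermiteTwo (normVec_zero hl) fun k => by fun_prop
    · exact sphIntegrable_hermiteTwo (normVec_one hl) fun k => by fun_prop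
    · exact sphIntegrable_hermiteTwo (normVec_two hl) fun k => by fun_prop
    · exact sphIntegrable_hermiteTwo (normVec_three hl) fun k => by fun_prop
    · exact sphIntegrable_hermiteTwo (normVec_four hl) fun k => by fun_prop
  · filter_upwards [hc] with ω hω
    rw [crossInt_two_four_eq hl hω, hermiteInt_zero_eq hl hω, hermiteInt_one_eq hl hω,
      hermiteInt_two_eq hl hω, hermiteInt_three_eq hl hω, hermiteInt_four_eq hl hω]
    refine ⟨?_, ?_, ?_, ?_, ?_, ?_⟩ <;>
      simp only [remainder, exactWeight, limitWeight, weightMean, Matrix.cons_val,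
        coeffSum_const_mul] <;>
      ring
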